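/- Let $n\ge 1$, let $\Omega\subset\mathbb R^n$ be a bounded open set with Lipschitz boundary, and let $0<s<1$. For an open set $U\subset\mathbb R^n$ let $H^s(U)$ be the space of real functions $\phi\in L^2(U)$ with $$\|\phi\|_{s,U}^2=\int_U|\phi|^2\,dx+\int_{U\times U}\frac{|\phi(x)-\phi(x')|^2}{|x-x'|^{n+2s}}\,dx\,dx'<\infty .$$ Let $Y=\,]0,1[^n$, let $\vec e_1,\dots,\vec e_n$ be the canonical basis and $[\,\cdot\,]$ the componentwise integer part. For $\varepsilon>0$ put $$\widehat\Omega_{\varepsilon,3}=\{x:\operatorname{dist}(x,\partial\Omega)<3\sqrt n\,\varepsilon\},\qquad \widetilde\Omega_{\varepsilon,3}=\{x:\operatorname{dist}(x,\Omega)<3\sqrt n\,\varepsilon\},$$ and, for $u\in L^2(\mathbb R^n)$, $$M_Y^\varepsilon(u)(x)=\frac1{|Y|}\int_Y u\Bigl(\varepsilon\Bigl[\frac x\varepsilon\Bigr]+\varepsilon z\Bigr)dz .$$ Let $\mathcal Q_\varepsilon(u)$ be the $Q_1$-interpolate of $M_Y^\varepsilon(u)$, that is, the continuous function on $\mathbb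 R^n$ which is affine in each variable separately on every cell $\varepsilon(\xi+\overline Y)$, $\xi\in\mathbb Z^n$, and equals $M_Y^\varepsilon(u)(\varepsilon\xi)$ at every node $\varepsilon\xi$, $\xi\in\mathbb Z^n$. There exists a bounded linear extension operator $\mathcal P:H^s(\Omega)\to H^s(\mathbb R^n)$, i.e. a linear map with $\mathcal P(\phi)=\phi$ a.e. on $\Omega$ and $\|\mathcal P(\phi)\|_{s,\mathbb R^n}\le K\|\phi\|_{s,\Omega}$ for some constant $K$ and all $\phi\in H^s(\Omega)$. Moreover, for every $K\ge0$ there is a constant $C>0$, depending only on $n$, $s$, $\Omega$ and $K$, such that for every such operator $\mathcal P$ with bound $K$, every $\varepsilon>0$ and every $\phi\in H^s(\Omega)$, the extension $\mathcal P(\phi)$ being still denoted $\phi$, $$\|\phi-M_Y^\varepsilon(\phi)\|_{L^2(\Omega)}\le C\varepsilon^s\|\phi\|_{s,\Omega},\qquad \|\phi-\mathcal Q_\varepsilon(\phi)\|_{L^2(\Omega)}\le C\varepsilon^s\|\phi\|_{s,\Omega},$$ $$\|\nabla\mathcal Q_\varepsilon(\phi)\|_{[L^2(\widetilde\Omega_{\varepsilon,3})]^n}\le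 C\varepsilon^{s-1}\|\phi\|_{s,\Omega},\qquad \|\phi\|_{L^2(\widehat\Omega_{\varepsilon,3})}\le C\varepsilon^{s/2}\|\phi\|_{s,\Omega},$$ $$\|\phi-\phi(\cdot+\varepsilon\vec e_i)\|_{L^2(\Omega)}\le C\varepsilon^s\|\phi\|_{s,\Omega}\quad(1\le i\le n),\qquad \|\mathcal Q_\varepsilon(\phi)\|_{L^2(\partial\Omega)}\le C\varepsilon^{(s-1)/2}\|\phi\|_{s,\Omega},$$ where $\nabla$ is the weak gradient. -/

import Mathlib

open MeasureTheory Set Metric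
open scoped ENNReal NNReal ContDiff RealInnerProductSpace

noncomputable section

/-- `ℝⁿ` with its Euclidean norm. -/
abbrev Rn (n : ℕ) : Type := EuclideanSpace ℝ (Fin n)

/-- The set `Ω` has Lipschitz boundary: near each boundary point there are a unit vector `e`
(the local vertical direction) and a Lipschitz function `γ` such that, in a neighbourhood of the
point, `Ω` is the set of points lying strictly above the graph of `γ`. The argument
`y - ⟪e, y⟫ e` of `γ` is the orthogonal projection of `y` on the hyperplane `e^⊥`. -/
def HasLipschitzBoundary {n : ℕ} (Ω : Set (Rn n)) : Prop :=
  ∀ x ∈ frontier Ω, ∃ (e : Rn n) (γ : Rn n → ℝ) (L : ℝ≥0) (r : ℝ),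
    ‖e‖ = 1 ∧ LipschitzWith L γ ∧ 0 < r ∧
      ∀ y ∈ ball x r, y ∈ Ω ↔ γ (y - ⟪e, y⟫ • e) < ⟪e, y⟫

/-- The norm `‖φ‖_{s,Ω}` of `H^s(Ω)`, with values in `[0, ∞]`: the square root of
`∫_Ω |φ|² + ∫_{Ω×Ω} |φ(x) - φ(x')|² / |x - x'|^(n+2s) dx dx'`. -/
def hsNorm {n : ℕ} (s : ℝ) (Ω : Set (Rn n)) (φ : Rn n → ℝ) : ℝ≥0∞ :=
  ((∫⁻ x in Ω, ENNReal.ofReal (φ x ^ 2)) +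
    ∫⁻ x in Ω, ∫⁻ x' in Ω,
      ENNReal.ofReal ((φ x - φ x') ^ 2 / ‖x - x'‖ ^ ((n : ℝ) + 2 * s))) ^ (1 / 2 : ℝ)

/-- `φ` is (a representative of) an element of `H^s(Ω)`. -/
def MemHs {n : ℕ} (s : ℝ) (Ω : Set (Rn n)) (φ : Rn n → ℝ) : Prop :=
  AEStronglyMeasurable φ (volume.restrict Ω) ∧ hsNorm s Ω φ < ⊤

/-- `P` is a linear extension operator from `H^s(Ω)` to `H^s(ℝⁿ)` of norm at most `K`. Elements
of these spaces are classes of functions modulo equality almost everywhere. -/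
structure IsHsExtension {n : ℕ} (s : ℝ) (Ω : Set (Rn n)) (K : ℝ≥0)
    (P : (Rn n → ℝ) → (Rn n → ℝ)) : Prop where
  memHs : ∀ φ, MemHs s Ω φ → MemHs s univ (P φ)
  extends_ae : ∀ φ, MemHs s Ω φ → P φ =ᵐ[volume.restrict Ω] φ
  linear_ae : ∀ (a b : ℝ) (φ ψ : Rn n → ℝ), MemHs s Ω φ → MemHs s Ω ψ →
    P (fun x => a * φ x + b * ψ x) =ᵐ[volume] fun x => a * P φ x + b * P ψ x
  norm_le : ∀ φ, MemHs s Ω φ → hsNorm s univ (P φ) ≤ K * hsNorm s Ω φ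

/-- The reference cell `Y = ]0,1[ⁿ`. -/
def unitCell (n : ℕ) : Set (Rn n) := {y | ∀ i, y i ∈ Ioo (0 : ℝ) 1}

/-- A point of `ℤⁿ` seen in `ℝⁿ`. -/
def latticePoint {n : ℕ} (ξ : Fin n → ℤ) : Rn n := WithLp.toLp 2 fun i => (ξ i : ℝ)

/-- The integer part `[x] ∈ ℤⁿ`, for which `x - [x]` lies in `Y` for almost every `x`. -/
def intPart {n : ℕ} (x : Rn n) : Fin n → ℤ := fun i => ⌊x i⌋

/-- The mean `(1/|Y|) ∫_Y φ(εξ + εz) dz` of `φ` over the cell `ε(ξ + Y)`. -/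
def cellMean {n : ℕ} (ε : ℝ) (φ : Rn n → ℝ) (ξ : Fin n → ℤ) : ℝ :=
  ⨍ z in unitCell n, φ (ε • latticePoint ξ + ε • z)

/-- The cell-average approximation `M_Y^ε(φ)(x) = (1/|Y|) ∫_Y φ(ε[x/ε] + εz) dz`. -/
def cellAverage {n : ℕ} (ε : ℝ) (φ : Rn n → ℝ) (x : Rn n) : ℝ :=
  cellMean ε φ (intPart (ε⁻¹ • x))

/-- `𝒬_ε(φ)`, the `Q₁`-interpolate of the discrete function `M_Y^ε(φ)`: the continuous function
that is affine in each variable on each cell `ε(ξ + Y)` and takes at each node `εξ`, `ξ ∈ ℤⁿ`,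
the value `M_Y^ε(φ)(εξ)`. A vertex of the cell of `x` is `ε([x/ε] + κ)` with `κ ∈ {0,1}ⁿ`. -/
def q1Interp {n : ℕ} (ε : ℝ) (φ : Rn n → ℝ) (x : Rn n) : ℝ :=
  ∑ κ : Fin n → Fin 2,
    cellMean ε φ (fun i => intPart (ε⁻¹ • x) i + ((κ i : ℕ) : ℤ)) *
      ∏ i, (if κ i = 1 then Int.fract ((ε⁻¹ • x) i) else 1 - Int.fract ((ε⁻¹ • x) i))

/-- `G` is the weak (distributional) gradient of `f` in the open set `U`. -/
def HasWeakGradientOn {n : ℕ} (U : Set (Rn n)) (f : Rn n → ℝ) (G : Rn n → Rn n) : Prop :=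
  LocallyIntegrableOn f U ∧ LocallyIntegrableOn G U ∧
    ∀ ψ : Rn n → ℝ, ContDiff ℝ ∞ ψ → HasCompactSupport ψ → tsupport ψ ⊆ U → ∀ i : Fin n,
      ∫ x in U, f x * fderiv ℝ ψ x (EuclideanSpace.single i 1) = -∫ x in U, G x i * ψ x

/-- `Ω̂_{ε,k}`, the set of points at distance less than `k √n ε` from `∂Ω`. -/
def boundaryLayer {n : ℕ} (Ω : Set (Rn n)) (ε : ℝ) (k : ℕ) : Set (Rn n) :=
  thickening (k * √n * ε) (frontier Ω)

/-- `Ω̃_{ε,k}`, the set of points at distance less than `k √n ε` from `Ω`. -/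
def enlargement {n : ℕ} (Ω : Set (Rn n)) (ε : ℝ) (k : ℕ) : Set (Rn n) :=
  thickening (k * √n * ε) Ω

/-- The surface measure on `∂Ω`: the `(n-1)`-dimensional Hausdorff measure restricted to `∂Ω`
(Mathlib's normalization differs from the classical one by a factor depending only on `n`). -/
def surfaceMeasure {n : ℕ} (Ω : Set (Rn n)) : Measure (Rn n) :=
  (Measure.hausdorffMeasure ((n : ℝ) - 1)).restrict (frontier Ω)

end

/-! For `|x - y| ≤ r` one has `(u x - u y)² ≤ r^(n+2s) · (u x - u y)² / |x - y|^(n+2s)`. A square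
difference averaged over a ball of radius of order `ε` therefore costs `ε^(-n) ε^(n+2s) = ε^(2s)`
times the Gagliardo energy. With Jensen's inequality this gives the cell-average estimate and, since
the interpolate is a convex combination of cell means within distance `3√n ε`, the interpolation
estimate. The gradient loses one factor `ε⁻¹`, the Lipschitz constant of the `Q₁` weights.
Translations are handled by comparing both values with a third point
(`exists_lintegral_sq_sub_translate_le`).

The boundary layer is covered by finitely many strips `0 ≤ h < w`, where `h` grows with unit speed
along `e`. Translation by `w e` carries a strip onto the adjacent one, so the mass `G w` of `u²`
satisfies `G w ≤ q G (2w) + c w^(2s) E` with `1/2 < q < 2^(-s)`, a choice possible because `s < 1`.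
Iteration gives `G w ≤ M w^s E` (`exists_lintegral_strip_le`), whence the rate `ε^(s/2)` for the
norm.

For the trace, `(𝒬_ε u)²` at a boundary point is at most a constant times `ε^(-n)` times the
integral of `u²` over a ball of radius `3√n ε`. By Fubini and the bound `r^(n-1)` for the surface
measure of balls, its boundary integral is at most `ε⁻¹` times the mass of the layer, that is of
order `ε^(s-1)`.

The extension is `∑ θᵢ · (φ ∘ Tᵢ)`: `Tᵢ` folds a neighbourhood of a piece of the boundary into `Ω`
by reflection along `e`, and `θᵢ` is a Lipschitz partition of unity. Folding and cutoff are bounded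
in `H^s` (`exists_hsEnergy_comp_le`, `exists_hsEnergy_cutoff_le`), the latter again because `0 < s <
1`. -/

/-- The Gagliardo double integral on `Ω × Ω`. -/
noncomputable def gagliardo {n : ℕ} (s : ℝ) (Ω : Set (Rn n)) (φ : Rn n → ℝ) : ℝ≥0∞ :=
  ∫⁻ x in Ω, ∫⁻ x' in Ω,
      ENNReal.ofReal ((φ x - φ x') ^ 2 / ‖x - x'‖ ^ ((n : ℝ) + 2 * s))

/-- The square of the `H^s(Ω)` norm. -/
noncomputable def hsEnergy {n : ℕ} (s : ℝ) (Ω : Set (Rn n)) (φ : Rn n → ℝ) : ℝ≥0∞ :=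
  (∫⁻ x in Ω, ENNReal.ofReal (φ x ^ 2)) + gagliardo s Ω φ

theorem hsNorm_eq_hsEnergy_rpow {n : ℕ} (s : ℝ) (Ω : Set (Rn n)) (φ : Rn n → ℝ) :
    hsNorm s Ω φ = hsEnergy s Ω φ ^ (1 / 2 : ℝ) := rfl

theorem hsEnergy_congr_ae {n : ℕ} {s : ℝ} {Ω : Set (Rn n)} {φ ψ : Rn n → ℝ}
    (h : φ =ᵐ[volume.restrict Ω] ψ) : hsEnergy s Ω φ = hsEnergy s Ω ψ := by
  unfold hsEnergy gagliardo
  congr 1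
  · exact lintegral_congr_ae (h.mono fun x hx => by simp only [hx])
  · refine lintegral_congr_ae (h.mono fun x hx => ?_)
    exact lintegral_congr_ae (h.mono fun y hy => by simp only [hx, hy])

theorem eLpNorm_two_le_of_lintegral_sq_le {α F : Type*} [MeasurableSpace α] [NormedAddCommGroup F]
    {μ : Measure α} {f : α → F} {c : ℝ} {E : ℝ≥0∞} (hc : 0 ≤ c)
    (h : ∫⁻ x, ENNReal.ofReal (‖f x‖ ^ 2) ∂μ ≤ ENNReal.ofReal (c ^ 2) * E) :
    eLpNorm f 2 μ ≤ ENNReal.ofReal c * E ^ (1 / 2 : ℝ) := by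
  rw [eLpNorm_eq_lintegral_rpow_enorm_toReal (by norm_num) (by norm_num)]
  have h1 : ENNReal.ofReal c * E ^ (1 / 2 : ℝ)
      = (ENNReal.ofReal (c ^ 2) * E) ^ (1 / 2 : ℝ) := by
    rw [ENNReal.mul_rpow_of_nonneg _ _ (by norm_num),
      ENNReal.ofReal_rpow_of_nonneg (by positivity) (by norm_num), ← Real.sqrt_eq_rpow,
      Real.sqrt_sq hc]
  rw [h1]
  refine ENNReal.rpow_le_rpow (le_trans (le_of_eq ?_) h) (by norm_num)
  refine lintegral_congr fun x => ?_
  rw [ENNReal.ofReal_pow (norm_nonneg _), ofReal_norm]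
  simp

theorem lintegral_sq_eq_eLpNorm_sq {α F : Type*} [MeasurableSpace α] [NormedAddCommGroup F]
    {μ : Measure α} (f : α → F) :
    ∫⁻ x, ENNReal.ofReal (‖f x‖ ^ 2) ∂μ = eLpNorm f 2 μ ^ 2 := by
  rw [eLpNorm_eq_lintegral_rpow_enorm_toReal (by norm_num) (by norm_num),
    ← ENNReal.rpow_natCast, ← ENNReal.rpow_mul]
  norm_num

/-! ### Differences at small distance and translations. -/

/-- On the diagonal the quotient takes the default value 0, which is why `hd` is required. -/
theorem ofReal_sq_sub_le_of_norm_lt {n : ℕ} {s r : ℝ} (hs : 0 < s) {x y : Rn n} {d : ℝ}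
    (hd : x = y → d = 0) (h : ‖x - y‖ ≤ r) :
    ENNReal.ofReal (d ^ 2) ≤ ENNReal.ofReal (r ^ ((n : ℝ) + 2 * s)) *
      ENNReal.ofReal (d ^ 2 / ‖x - y‖ ^ ((n : ℝ) + 2 * s)) := by
  have hr : 0 ≤ r := (norm_nonneg _).trans h
  rw [← ENNReal.ofReal_mul (by positivity)]
  apply ENNReal.ofReal_le_ofReal
  by_cases hxy : x = y
  · simp [hd hxy]
  · have h0 : 0 < ‖x - y‖ := norm_pos_iff.2 (sub_ne_zero.2 hxy)
    have h1 : ‖x - y‖ ^ ((n : ℝ) + 2 * s) ≤ r ^ ((n : ℝ) + 2 * s) :=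
      Real.rpow_le_rpow h0.le h (by positivity)
    have h2 : 0 < ‖x - y‖ ^ ((n : ℝ) + 2 * s) := Real.rpow_pos_of_pos h0 _
    calc d ^ 2 = ‖x - y‖ ^ ((n : ℝ) + 2 * s) * (d ^ 2 / ‖x - y‖ ^ ((n : ℝ) + 2 * s)) := by
          field_simp
      _ ≤ _ := by gcongr

theorem lintegral_lintegral_ball_sq_sub_le {n : ℕ} {s : ℝ} (hs : 0 < s) (u : Rn n → ℝ) (r : ℝ) :
    ∫⁻ x, ∫⁻ y in ball x r, ENNReal.ofReal ((u x - u y) ^ 2) ≤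
      ENNReal.ofReal (r ^ ((n : ℝ) + 2 * s)) * gagliardo s univ u := by
  unfold gagliardo
  simp only [Measure.restrict_univ]
  rw [← lintegral_const_mul' _ _ ENNReal.ofReal_ne_top]
  refine lintegral_mono fun x => ?_
  rw [← lintegral_const_mul' _ _ ENNReal.ofReal_ne_top]
  refine (setLIntegral_mono' measurableSet_ball fun y hy => ?_).trans (setLIntegral_le_lintegral _ _)
  refine ofReal_sq_sub_le_of_norm_lt hs (fun h => by simp [h]) ?_
  rw [mem_ball, dist_comm, dist_eq_norm] at hy
  exact hy.le

theorem measurable_lintegral_ball {n : ℕ} {F : Rn n → Rn n → ℝ≥0∞}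
    (hF : Measurable (Function.uncurry F)) (r : ℝ) :
    Measurable fun x => ∫⁻ y in ball x r, F x y := by
  have h1 : ∀ x, ∫⁻ y in ball x r, F x y =
      ∫⁻ y, {p : Rn n × Rn n | dist p.2 p.1 < r}.indicator (Function.uncurry F) (x, y) := by
    intro x
    rw [← lintegral_indicator measurableSet_ball]
    refine lintegral_congr fun y => ?_
    simp [indicator, Function.uncurry]
  simp_rw [h1]
  refine Measurable.lintegral_prod_right' (hF.indicator ?_)
  exact measurableSet_lt (by fun_prop) (by fun_prop)

theorem ofReal_sq_sub_le_two_mul (a b c : ℝ) : ENNReal.ofReal ((a - b) ^ 2) ≤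
    2 * ENNReal.ofReal ((a - c) ^ 2) + 2 * ENNReal.ofReal ((b - c) ^ 2) := by
  have h2 : (2 : ℝ≥0∞) = ENNReal.ofReal 2 := by simp
  rw [h2, ← ENNReal.ofReal_mul (by norm_num), ← ENNReal.ofReal_mul (by norm_num),
    ← ENNReal.ofReal_add (by positivity) (by positivity)]
  exact ENNReal.ofReal_le_ofReal (by nlinarith [sq_nonneg (a - c + (b - c))])

/-- Both `u x` and `u (x + v)` are compared with `u y`, averaged over `y` in the ball of radius `r =
‖v‖` about `x`, which lies in the ball of radius `2r` about `x + v`. Dividing `r^(n+2s)` by the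
volume `r^n β` leaves `‖v‖^(2s)`. -/
theorem exists_lintegral_sq_sub_translate_le {n : ℕ} {s : ℝ} (hs : 0 < s) :
    ∃ C : ℝ, 0 ≤ C ∧ ∀ u : Rn n → ℝ, Measurable u → ∀ v : Rn n,
      ∫⁻ x, ENNReal.ofReal ((u x - u (x + v)) ^ 2) ≤
        ENNReal.ofReal (C * ‖v‖ ^ (2 * s)) * gagliardo s univ u := by
  have hβ : 0 < volume (ball (0 : Rn n) 1) := measure_ball_pos _ _ one_pos
  have hβt : volume (ball (0 : Rn n) 1) ≠ ⊤ := measure_ball_lt_top.ne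
  set β := (volume (ball (0 : Rn n) 1)).toReal with hβdef
  have hβ0 : 0 < β := ENNReal.toReal_pos hβ.ne' hβt
  refine ⟨(2 + 2 * 2 ^ ((n : ℝ) + 2 * s)) / β, by positivity, fun u hu v => ?_⟩
  rcases eq_or_ne v 0 with rfl | hv
  · simp
  have hr : 0 < ‖v‖ := norm_pos_iff.2 hv
  set r := ‖v‖ with hrdef
  have hmeas : ∀ ρ : ℝ, Measurable fun x =>
      ∫⁻ y in ball x ρ, ENNReal.ofReal ((u x - u y) ^ 2) := fun ρ =>
    measurable_lintegral_ball (F := fun x y => ENNReal.ofReal ((u x - u y) ^ 2))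
      (by unfold Function.uncurry; fun_prop) ρ
  have hvol : ∀ x : Rn n, volume (ball x r) = ENNReal.ofReal (r ^ n * β) := by
    intro x
    rw [Measure.addHaar_ball_of_pos _ _ hr, ENNReal.ofReal_mul (by positivity), hβdef,
      ENNReal.ofReal_toReal hβt]
    simp
  have key : ∀ x, ENNReal.ofReal (r ^ n * β) * ENNReal.ofReal ((u x - u (x + v)) ^ 2) ≤
      2 * (∫⁻ y in ball x r, ENNReal.ofReal ((u x - u y) ^ 2)) +
      2 * ∫⁻ y in ball (x + v) (2 * r), ENNReal.ofReal ((u (x + v) - u y) ^ 2) := by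
    intro x
    rw [mul_comm, ← hvol x, ← setLIntegral_const, ← lintegral_const_mul _ (by fun_prop),
      ← lintegral_const_mul _ (by fun_prop)]
    have hsub : ball x r ⊆ ball (x + v) (2 * r) := by
      refine ball_subset_ball' ?_
      rw [dist_eq_norm]; simp [← hrdef]; linarith
    refine le_trans ?_ (add_le_add le_rfl (lintegral_mono_set hsub))
    rw [← lintegral_add_left (by fun_prop)]
    exact lintegral_mono fun y => ofReal_sq_sub_le_two_mul _ _ _
  have h1 : ENNReal.ofReal (r ^ n * β) * ∫⁻ x, ENNReal.ofReal ((u x - u (x + v)) ^ 2) ≤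
      ENNReal.ofReal ((2 + 2 * 2 ^ ((n : ℝ) + 2 * s)) * r ^ ((n : ℝ) + 2 * s))
        * gagliardo s univ u := by
    rw [← lintegral_const_mul' _ _ ENNReal.ofReal_ne_top]
    refine (lintegral_mono key).trans ?_
    rw [lintegral_add_left ((hmeas r).const_mul 2), lintegral_const_mul _ (hmeas r),
      lintegral_const_mul' _ _ (by norm_num)]
    rw [lintegral_add_right_eq_self
      (fun x => ∫⁻ y in ball x (2 * r), ENNReal.ofReal ((u x - u y) ^ 2)) v]
    refine (add_le_add (mul_le_mul_right (lintegral_lintegral_ball_sq_sub_le hs u r) _)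
      (mul_le_mul_right (lintegral_lintegral_ball_sq_sub_le hs u (2 * r)) _)).trans (le_of_eq ?_)
    have h2 : (2 : ℝ≥0∞) = ENNReal.ofReal 2 := by simp
    rw [h2, ← mul_assoc, ← mul_assoc, ← ENNReal.ofReal_mul (by norm_num),
      ← ENNReal.ofReal_mul (by norm_num), ← add_mul, ← ENNReal.ofReal_add (by positivity)
      (by positivity), Real.mul_rpow (by norm_num) hr.le]
    congr 2
    ring
  have hpos : 0 < r ^ n * β := by positivity
  have h3 : ENNReal.ofReal (r ^ n * β) ≠ 0 := (ENNReal.ofReal_pos.2 hpos).ne'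
  rw [← ENNReal.mul_le_mul_iff_right h3 ENNReal.ofReal_ne_top]
  refine h1.trans (le_of_eq ?_)
  rw [← mul_assoc, ← ENNReal.ofReal_mul hpos.le, Real.rpow_add hr, Real.rpow_natCast]
  congr 2
  field_simp

/-! ### Cell means and the `L²` error of the interpolate. -/

/-- Jensen's inequality. Integrability need not be assumed: without square integrability the
right-hand side is infinite. -/
theorem ofReal_sq_sub_integral_le {α : Type*} [MeasurableSpace α] (μ : Measure α)
    [IsProbabilityMeasure μ] {f : α → ℝ} (hf : AEStronglyMeasurable f μ) (a : ℝ) :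
    ENNReal.ofReal ((a - ∫ z, f z ∂μ) ^ 2) ≤ ∫⁻ z, ENNReal.ofReal ((a - f z) ^ 2) ∂μ := by
  have hg : AEStronglyMeasurable (fun z => a - f z) μ := aestronglyMeasurable_const.sub hf
  have hL : ∫⁻ z, ENNReal.ofReal ((a - f z) ^ 2) ∂μ = eLpNorm (fun z => a - f z) 2 μ ^ 2 := by
    rw [← lintegral_sq_eq_eLpNorm_sq]; simp
  rw [hL]
  by_cases hfin : eLpNorm (fun z => a - f z) 2 μ = ⊤
  · simp [hfin]
  have hmem : MemLp (fun z => a - f z) 2 μ := ⟨hg, lt_top_iff_ne_top.2 hfin⟩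
  have hint : Integrable (fun z => a - f z) μ := hmem.integrable (by norm_num)
  have hfi : Integrable f μ := by
    have := (integrable_const a).sub hint
    refine this.congr (Filter.Eventually.of_forall fun z => by simp)
  have h1 : a - ∫ z, f z ∂μ = ∫ z, (a - f z) ∂μ := by
    rw [integral_sub (integrable_const a) hfi]; simp
  have h2 : ENNReal.ofReal ((a - ∫ z, f z ∂μ) ^ 2) = ‖∫ z, (a - f z) ∂μ‖ₑ ^ 2 := by
    rw [h1, ← sq_abs, ENNReal.ofReal_pow (abs_nonneg _), ← Real.norm_eq_abs, ofReal_norm]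
  rw [h2]
  gcongr
  calc ‖∫ z, (a - f z) ∂μ‖ₑ ≤ ∫⁻ z, ‖a - f z‖ₑ ∂μ := enorm_integral_le_lintegral_enorm _
    _ = eLpNorm (fun z => a - f z) 1 μ := eLpNorm_one_eq_lintegral_enorm.symm
    _ ≤ _ := eLpNorm_le_eLpNorm_of_exponent_le (by norm_num) hg

theorem unitCell_eq_preimage (n : ℕ) :
    unitCell n = WithLp.ofLp ⁻¹' (univ.pi fun _ : Fin n => Ioo (0 : ℝ) 1) := by
  ext y; simp [unitCell]

theorem measurableSet_unitCell (n : ℕ) : MeasurableSet (unitCell n) := by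
  rw [unitCell_eq_preimage]
  exact (PiLp.volume_preserving_ofLp (Fin n)).measurable
    (MeasurableSet.univ_pi fun _ => measurableSet_Ioo)

theorem volume_unitCell (n : ℕ) : volume (unitCell n) = 1 := by
  rw [unitCell_eq_preimage, (PiLp.volume_preserving_ofLp (Fin n)).measure_preimage
    (MeasurableSet.univ_pi fun _ => measurableSet_Ioo).nullMeasurableSet]
  simp [volume_pi_pi]

instance isProbabilityMeasure_restrict_unitCell (n : ℕ) :
    IsProbabilityMeasure ((volume : Measure (Rn n)).restrict (unitCell n)) :=
  ⟨by simp [volume_unitCell]⟩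

theorem cellMean_eq_integral {n : ℕ} (ε : ℝ) (φ : Rn n → ℝ) (ξ : Fin n → ℤ) :
    cellMean ε φ ξ = ∫ z in unitCell n, φ (ε • latticePoint ξ + ε • z) := by
  unfold cellMean
  rw [average_eq_integral]

theorem map_affine_volume {n : ℕ} {ε : ℝ} (hε : 0 < ε) (c : Rn n) :
    (volume : Measure (Rn n)).map (fun z => c + ε • z) =
      ENNReal.ofReal ((ε ^ n)⁻¹) • (volume : Measure (Rn n)) := by
  have h := Measure.map_addHaar_smul (volume : Measure (Rn n)) hε.ne'
  rw [finrank_euclideanSpace_fin, abs_of_nonneg (by positivity)] at h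
  have h2 : (fun z : Rn n => c + ε • z) = (fun w => c + w) ∘ (fun z => ε • z) := rfl
  rw [h2, ← Measure.map_map (by fun_prop) (by fun_prop), h, Measure.map_smul]
  congr 1
  exact map_add_left_eq_self volume c

theorem lintegral_unitCell_le {n : ℕ} {ε : ℝ} (hε : 0 < ε) (c : Rn n) {S : Set (Rn n)}
    (hS : MeasurableSet S) (h : ∀ z ∈ unitCell n, c + ε • z ∈ S) {F : Rn n → ℝ≥0∞}
    (hF : Measurable F) :
    ∫⁻ z in unitCell n, F (c + ε • z) ≤ ENNReal.ofReal ((ε ^ n)⁻¹) * ∫⁻ y in S, F y := by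
  calc ∫⁻ z in unitCell n, F (c + ε • z)
      ≤ ∫⁻ z in unitCell n, S.indicator F (c + ε • z) :=
        setLIntegral_mono' (measurableSet_unitCell n) fun z hz => by
          rw [indicator_of_mem (h z hz)]
    _ ≤ ∫⁻ z, S.indicator F (c + ε • z) := setLIntegral_le_lintegral _ _
    _ = ∫⁻ y, S.indicator F y ∂((volume : Measure (Rn n)).map (fun z => c + ε • z)) :=
        (lintegral_map (hF.indicator hS) (by fun_prop)).symm
    _ = _ := by
        rw [map_affine_volume hε, lintegral_smul_measure, lintegral_indicator hS, smul_eq_mul]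

theorem ofReal_sq_sub_cellMean_le {n : ℕ} {ε : ℝ} (hε : 0 < ε) {u : Rn n → ℝ} (hu : Measurable u)
    (a : ℝ) (ξ : Fin n → ℤ) {S : Set (Rn n)} (hS : MeasurableSet S)
    (h : ∀ z ∈ unitCell n, ε • latticePoint ξ + ε • z ∈ S) :
    ENNReal.ofReal ((a - cellMean ε u ξ) ^ 2) ≤
      ENNReal.ofReal ((ε ^ n)⁻¹) * ∫⁻ y in S, ENNReal.ofReal ((a - u y) ^ 2) := by
  rw [cellMean_eq_integral]
  refine (ofReal_sq_sub_integral_le _ (f := fun z => u (ε • latticePoint ξ + ε • z))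
    (Measurable.aestronglyMeasurable (by fun_prop)) a).trans ?_
  exact lintegral_unitCell_le hε _ hS h (F := fun y => ENNReal.ofReal ((a - u y) ^ 2)) (by fun_prop)

/-- Cell means depend only on the class of `u`, so the interpolates of two representatives agree at
every point. This matters for the trace, since `∂Ω` is a null set. -/
theorem cellMean_congr_ae {n : ℕ} {ε : ℝ} (hε : 0 < ε) {u v : Rn n → ℝ} (h : u =ᵐ[volume] v)
    (ξ : Fin n → ℤ) : cellMean ε u ξ = cellMean ε v ξ := by
  rw [cellMean_eq_integral, cellMean_eq_integral]
  have hq : Measure.QuasiMeasurePreserving (fun z : Rn n => ε • latticePoint ξ + ε • z)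
      volume volume := by
    refine ⟨by fun_prop, ?_⟩
    rw [map_affine_volume hε]
    exact Measure.smul_absolutelyContinuous
  exact integral_congr_ae (ae_restrict_of_ae (hq.ae_eq h))

theorem q1Interp_congr_ae {n : ℕ} {ε : ℝ} (hε : 0 < ε) {u v : Rn n → ℝ} (h : u =ᵐ[volume] v) :
    q1Interp ε u = q1Interp ε v := by
  ext x
  unfold q1Interp
  simp only [cellMean_congr_ae hε h]

theorem cellAverage_congr_ae {n : ℕ} {ε : ℝ} (hε : 0 < ε) {u v : Rn n → ℝ} (h : u =ᵐ[volume] v) :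
    cellAverage ε u = cellAverage ε v := by
  ext x
  exact cellMean_congr_ae hε h _

/-- The value of `M_Y^ε(u)` at the vertex `ε([x/ε] + κ)` of the cell of `x`. -/
noncomputable def vertexMean {n : ℕ} (ε : ℝ) (u : Rn n → ℝ) (x : Rn n) (κ : Fin n → Fin 2) : ℝ :=
  cellMean ε u (fun i => intPart (ε⁻¹ • x) i + ((κ i : ℕ) : ℤ))

/-- The `Q₁` weight at `x` of the vertex `ε([x/ε] + κ)` of the cell of `x`. -/
noncomputable def vertexWeight {n : ℕ} (ε : ℝ) (x : Rn n) (κ : Fin n → Fin 2) : ℝ :=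
  ∏ i, (if κ i = 1 then Int.fract ((ε⁻¹ • x) i) else 1 - Int.fract ((ε⁻¹ • x) i))

theorem q1Interp_eq_sum {n : ℕ} (ε : ℝ) (u : Rn n → ℝ) (x : Rn n) :
    q1Interp ε u x = ∑ κ, vertexMean ε u x κ * vertexWeight ε x κ := rfl

theorem cellAverage_eq_vertexMean {n : ℕ} (ε : ℝ) (u : Rn n → ℝ) (x : Rn n) :
    cellAverage ε u x = vertexMean ε u x 0 := by
  simp [cellAverage, vertexMean]

theorem vertexWeight_nonneg {n : ℕ} (ε : ℝ) (x : Rn n) (κ : Fin n → Fin 2) :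
    0 ≤ vertexWeight ε x κ := by
  refine Finset.prod_nonneg fun i _ => ?_
  split_ifs
  · exact Int.fract_nonneg _
  · linarith [Int.fract_lt_one ((ε⁻¹ • x) i)]

theorem sum_vertexWeight {n : ℕ} (ε : ℝ) (x : Rn n) : ∑ κ, vertexWeight ε x κ = 1 := by
  unfold vertexWeight
  have h := Finset.prod_univ_sum (fun _ : Fin n => (Finset.univ : Finset (Fin 2)))
    (fun i j => if j = 1 then Int.fract ((ε⁻¹ • x) i) else 1 - Int.fract ((ε⁻¹ • x) i))
  rw [Fintype.piFinset_univ] at h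
  rw [← h]
  refine Finset.prod_eq_one fun i _ => ?_
  simp

theorem vertexWeight_le_one {n : ℕ} (ε : ℝ) (x : Rn n) (κ : Fin n → Fin 2) :
    vertexWeight ε x κ ≤ 1 := by
  rw [← sum_vertexWeight ε x]
  exact Finset.single_le_sum (fun i _ => vertexWeight_nonneg ε x i) (Finset.mem_univ κ)

theorem sub_q1Interp_eq_sum {n : ℕ} (ε : ℝ) (u : Rn n → ℝ) (x : Rn n) (a : ℝ) :
    a - q1Interp ε u x = ∑ κ, vertexWeight ε x κ * (a - vertexMean ε u x κ) := by
  simp only [mul_sub, Finset.sum_sub_distrib]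
  rw [← Finset.sum_mul, sum_vertexWeight, one_mul, q1Interp_eq_sum]
  simp only [mul_comm]

/-- Convexity of the square, the weights being nonnegative of sum 1. It is used with `a = u x` for
the error and with `a = 0` for the size of the interpolate. -/
theorem sq_sub_q1Interp_le {n : ℕ} (ε : ℝ) (u : Rn n → ℝ) (x : Rn n) (a : ℝ) :
    (a - q1Interp ε u x) ^ 2 ≤ ∑ κ, (a - vertexMean ε u x κ) ^ 2 := by
  rw [sub_q1Interp_eq_sum]
  refine (Real.pow_arith_mean_le_arith_mean_pow_of_even Finset.univ _ _
    (fun κ _ => vertexWeight_nonneg ε x κ) (sum_vertexWeight ε x) even_two).trans ?_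
  refine Finset.sum_le_sum fun κ _ => ?_
  exact mul_le_of_le_one_left (sq_nonneg _) (vertexWeight_le_one ε x κ)

/-- Each coordinate differs from that of `x` by at most `2ε`, so the distance is at most `2√n ε`; `0
< n` makes this strictly less than `3√n ε`. -/
theorem vertexCell_subset_ball {n : ℕ} (hn : 0 < n) {ε : ℝ} (hε : 0 < ε) (x : Rn n)
    (κ : Fin n → Fin 2) {z : Rn n} (hz : z ∈ unitCell n) :
    ε • latticePoint (fun i => intPart (ε⁻¹ • x) i + ((κ i : ℕ) : ℤ)) + ε • z ∈
      ball x (3 * √n * ε) := by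
  rw [mem_ball, EuclideanSpace.dist_eq]
  have hi : ∀ i, dist ((ε • latticePoint (fun i => intPart (ε⁻¹ • x) i + ((κ i : ℕ) : ℤ))
      + ε • z : Rn n) i) (x i) ^ 2 ≤ (2 * ε) ^ 2 := by
    intro i
    rw [Real.dist_eq, sq_abs]
    refine sq_le_sq' ?_ ?_
    all_goals
      have h1 : x i = ε * ((⌊ε⁻¹ * x i⌋ : ℝ) + Int.fract (ε⁻¹ * x i)) := by
        rw [Int.floor_add_fract]; field_simp
      have h2 := Int.fract_nonneg (ε⁻¹ * x i)
      have h3 := Int.fract_lt_one (ε⁻¹ * x i)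
      have h4 := (hz i).1
      have h5 := (hz i).2
      have h6 : ((κ i : ℕ) : ℝ) ≤ 1 := by exact_mod_cast Nat.lt_succ_iff.1 (κ i).2
      have h7 : (0 : ℝ) ≤ ((κ i : ℕ) : ℝ) := by positivity
      have h8 : (ε • latticePoint (fun i => intPart (ε⁻¹ • x) i + ((κ i : ℕ) : ℤ)) + ε • z : Rn n) i
          - x i = ε * (((κ i : ℕ) : ℝ) + z i - Int.fract (ε⁻¹ * x i)) := by
        have h9 : (ε • latticePoint (fun i => intPart (ε⁻¹ • x) i + ((κ i : ℕ) : ℤ)) + ε • z : Rn n) i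
            = ε * ((⌊ε⁻¹ * x i⌋ : ℝ) + ((κ i : ℕ) : ℝ)) + ε * z i := by
          simp [latticePoint, intPart]
        rw [h9]
        linear_combination -h1
      rw [h8]
      nlinarith
  have h2 : √(∑ i, dist ((ε • latticePoint (fun i => intPart (ε⁻¹ • x) i + ((κ i : ℕ) : ℤ))
      + ε • z : Rn n) i) (x i) ^ 2) ≤ √(n * (2 * ε) ^ 2) := by
    refine Real.sqrt_le_sqrt ((Finset.sum_le_sum fun i _ => hi i).trans ?_)
    simp
  refine h2.trans_lt ?_
  rw [Real.sqrt_mul (by positivity), Real.sqrt_sq (by positivity)]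
  have : 0 < √(n : ℝ) := Real.sqrt_pos.2 (by exact_mod_cast hn)
  nlinarith [mul_pos this hε]

theorem sum_ofReal_sq_sub_vertexMean_le {n : ℕ} (hn : 0 < n) {ε : ℝ} (hε : 0 < ε) {u : Rn n → ℝ}
    (hu : Measurable u) (x : Rn n) (a : ℝ) :
    ∑ κ, ENNReal.ofReal ((a - vertexMean ε u x κ) ^ 2) ≤
      ENNReal.ofReal (2 ^ n * (ε ^ n)⁻¹) *
        ∫⁻ y in ball x (3 * √n * ε), ENNReal.ofReal ((a - u y) ^ 2) := by
  refine (Finset.sum_le_sum fun κ _ => ofReal_sq_sub_cellMean_le hε hu a _ measurableSet_ball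
    (fun z hz => vertexCell_subset_ball hn hε x κ hz)).trans (le_of_eq ?_)
  simp [ENNReal.ofReal_mul, ENNReal.ofReal_pow, mul_assoc]

theorem lintegral_sum_sq_sub_vertexMean_le {n : ℕ} (hn : 0 < n) {s : ℝ} (hs : 0 < s) {ε : ℝ}
    (hε : 0 < ε) {u : Rn n → ℝ} (hu : Measurable u) :
    ∫⁻ x, ∑ κ, ENNReal.ofReal ((u x - vertexMean ε u x κ) ^ 2) ≤
      ENNReal.ofReal (2 ^ n * (3 * √n) ^ ((n : ℝ) + 2 * s) * ε ^ (2 * s)) *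
        gagliardo s univ u := by
  refine (lintegral_mono fun x => sum_ofReal_sq_sub_vertexMean_le hn hε hu x (u x)).trans ?_
  rw [lintegral_const_mul' _ _ ENNReal.ofReal_ne_top]
  refine (mul_le_mul_right (lintegral_lintegral_ball_sq_sub_le hs u _) _).trans (le_of_eq ?_)
  rw [← mul_assoc, ← ENNReal.ofReal_mul (by positivity), Real.mul_rpow (by positivity) hε.le,
    Real.rpow_add hε, Real.rpow_natCast]
  congr 2
  field_simp

theorem ofReal_sq_q1Interp_le {n : ℕ} (hn : 0 < n) {ε : ℝ} (hε : 0 < ε) {u : Rn n → ℝ}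
    (hu : Measurable u) (x : Rn n) :
    ENNReal.ofReal (q1Interp ε u x ^ 2) ≤ ENNReal.ofReal (2 ^ n * (ε ^ n)⁻¹) *
        ∫⁻ y in ball x (3 * √n * ε), ENNReal.ofReal (u y ^ 2) := by
  have h := sq_sub_q1Interp_le ε u x 0
  have h2 := sum_ofReal_sq_sub_vertexMean_le hn hε hu x 0
  simp only [zero_sub, even_two, Even.neg_pow] at h h2
  refine (ENNReal.ofReal_le_ofReal h).trans ?_
  rwa [ENNReal.ofReal_sum_of_nonneg fun κ _ => sq_nonneg _]

theorem lintegral_sq_sub_cellAverage_le {n : ℕ} (hn : 0 < n) {s : ℝ} (hs : 0 < s) {ε : ℝ}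
    (hε : 0 < ε) {u : Rn n → ℝ} (hu : Measurable u) :
    ∫⁻ x, ENNReal.ofReal ((u x - cellAverage ε u x) ^ 2) ≤
      ENNReal.ofReal (2 ^ n * (3 * √n) ^ ((n : ℝ) + 2 * s) * ε ^ (2 * s)) *
        gagliardo s univ u := by
  refine le_trans (lintegral_mono fun x => ?_) (lintegral_sum_sq_sub_vertexMean_le hn hs hε hu)
  rw [cellAverage_eq_vertexMean]
  exact Finset.single_le_sum (f := fun κ => ENNReal.ofReal ((u x - vertexMean ε u x κ) ^ 2))
    (fun i _ => zero_le) (Finset.mem_univ 0)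

theorem lintegral_sq_sub_q1Interp_le {n : ℕ} (hn : 0 < n) {s : ℝ} (hs : 0 < s) {ε : ℝ}
    (hε : 0 < ε) {u : Rn n → ℝ} (hu : Measurable u) :
    ∫⁻ x, ENNReal.ofReal ((u x - q1Interp ε u x) ^ 2) ≤
      ENNReal.ofReal (2 ^ n * (3 * √n) ^ ((n : ℝ) + 2 * s) * ε ^ (2 * s)) *
        gagliardo s univ u := by
  refine le_trans (lintegral_mono fun x => ?_) (lintegral_sum_sq_sub_vertexMean_le hn hs hε hu)
  refine (ENNReal.ofReal_le_ofReal (sq_sub_q1Interp_le ε u x (u x))).trans (le_of_eq ?_)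
  exact ENNReal.ofReal_sum_of_nonneg fun κ _ => sq_nonneg _

/-! ### Regularity and gradient of the `Q₁` interpolate. -/

theorem abs_prod_sub_prod_le_sum {ι : Type*} (S : Finset ι) {a b : ι → ℝ}
    (ha : ∀ i, |a i| ≤ 1) (hb : ∀ i, |b i| ≤ 1) :
    |∏ i ∈ S, a i - ∏ i ∈ S, b i| ≤ ∑ i ∈ S, |a i - b i| := by
  classical
  induction S using Finset.induction_on with
  | empty => simp
  | insert j S hj ih =>
    rw [Finset.prod_insert hj, Finset.prod_insert hj, Finset.sum_insert hj]
    have h1 : a j * ∏ i ∈ S, a i - b j * ∏ i ∈ S, b i =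
        (a j - b j) * ∏ i ∈ S, a i + b j * (∏ i ∈ S, a i - ∏ i ∈ S, b i) := by ring
    have h2 : |∏ i ∈ S, a i| ≤ 1 := by
      rw [Finset.abs_prod]
      exact Finset.prod_le_one (fun i _ => abs_nonneg _) fun i _ => ha i
    rw [h1]
    refine (abs_add_le _ _).trans (add_le_add ?_ ?_)
    · rw [abs_mul]
      exact mul_le_of_le_one_right (abs_nonneg _) h2
    · rw [abs_mul]
      exact (mul_le_of_le_one_left (abs_nonneg _) (hb j)).trans ih

/-- The one-dimensional hat function. -/
noncomputable def hat (t : ℝ) : ℝ := max 0 (1 - |t|)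

theorem abs_hat_le_one (t : ℝ) : |hat t| ≤ 1 := by
  unfold hat
  rw [abs_of_nonneg (le_max_left _ _)]
  exact max_le zero_le_one (by linarith [abs_nonneg t])

theorem abs_hat_sub_hat_le (t t' : ℝ) : |hat t - hat t'| ≤ |t - t'| := by
  unfold hat
  refine (abs_max_sub_max_le_max _ _ _ _).trans ?_
  simp only [sub_self, abs_zero]
  refine max_le (abs_nonneg _) ?_
  have h : 1 - |t| - (1 - |t'|) = |t'| - |t| := by ring
  rw [h, abs_sub_comm t t']
  exact abs_abs_sub_abs_le _ _

/-- The `Q₁` basis function of the node `εξ`. -/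
noncomputable def nodeFun {n : ℕ} (ε : ℝ) (ξ : Fin n → ℤ) (x : Rn n) : ℝ :=
  ∏ i, hat (ε⁻¹ * x i - ξ i)

theorem abs_nodeFun_sub_le {n : ℕ} {ε : ℝ} (hε : 0 < ε) (ξ : Fin n → ℤ) (x y : Rn n) :
    |nodeFun ε ξ x - nodeFun ε ξ y| ≤ n * ε⁻¹ * ‖x - y‖ := by
  unfold nodeFun
  refine (abs_prod_sub_prod_le_sum _ (fun i => abs_hat_le_one _) fun i => abs_hat_le_one _).trans ?_
  have h : ∀ i ∈ (Finset.univ : Finset (Fin n)),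
      |hat (ε⁻¹ * x i - ξ i) - hat (ε⁻¹ * y i - ξ i)| ≤ ε⁻¹ * ‖x - y‖ := by
    intro i _
    refine (abs_hat_sub_hat_le _ _).trans ?_
    have h1 : ε⁻¹ * x i - ξ i - (ε⁻¹ * y i - ξ i) = ε⁻¹ * (x - y) i := by
      simp; ring
    rw [h1, abs_mul, abs_of_pos (inv_pos.2 hε)]
    gcongr
    exact PiLp.norm_apply_le (x - y) i
  refine (Finset.sum_le_sum h).trans (le_of_eq ?_)
  simp; ring

/-- The weights are defined cell by cell through fractional parts; the products of hat functions are
globally Lipschitz, which gives continuity across the faces. -/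
theorem vertexWeight_eq_nodeFun {n : ℕ} (ε : ℝ) (x : Rn n) (κ : Fin n → Fin 2) :
    vertexWeight ε x κ = nodeFun ε (fun i => intPart (ε⁻¹ • x) i + ((κ i : ℕ) : ℤ)) x := by
  unfold vertexWeight nodeFun
  refine Finset.prod_congr rfl fun i _ => ?_
  have h1 := Int.fract_nonneg (ε⁻¹ * x i)
  have h2 := Int.fract_lt_one (ε⁻¹ * x i)
  have h3 := Int.floor_add_fract (ε⁻¹ * x i)
  have h4 : ∀ k : ℝ, ε⁻¹ * x i - ((⌊ε⁻¹ * x i⌋ : ℝ) + k) = Int.fract (ε⁻¹ * x i) - k := by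
    intro k; linarith
  rcases Fin.exists_fin_two.1 ⟨κ i, rfl⟩ with h | h
  · simp only [intPart, PiLp.smul_apply, smul_eq_mul, Int.cast_add]
    rw [h4]
    simp [hat, h, abs_of_nonneg h1, h2.le]
  · simp only [intPart, PiLp.smul_apply, smul_eq_mul, Int.cast_add]
    rw [h4]
    simp [hat, h, abs_of_nonpos (sub_nonpos.2 h2.le), h1]

theorem hat_eq_zero_of_ne {t : ℝ} {k : ℤ} (h0 : k ≠ ⌊t⌋) (h1 : k ≠ ⌊t⌋ + 1) : hat (t - k) = 0 := by
  unfold hat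
  rw [max_eq_left]
  rw [sub_nonpos, le_abs]
  rcases lt_or_gt_of_ne h0 with h | h
  · left
    have : ((k + 1 : ℤ) : ℝ) ≤ t := (Int.cast_le.2 (by omega)).trans (Int.floor_le t)
    push_cast at this; linarith
  · right
    have h2 : ((⌊t⌋ + 2 : ℤ) : ℝ) ≤ k := Int.cast_le.2 (by omega)
    have := Int.lt_floor_add_one t
    push_cast at h2; linarith

/-- Basis functions of nodes that are not vertices of the cell of `x` vanish at `x`. Since `F` may
be larger than the vertex set, one finite sum serves for a whole ball. -/
theorem q1Interp_eq_sum_nodeFun {n : ℕ} (ε : ℝ) (u : Rn n → ℝ) (x : Rn n)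
    (F : Finset (Fin n → ℤ))
    (hF : ∀ κ : Fin n → Fin 2, (fun i => intPart (ε⁻¹ • x) i + ((κ i : ℕ) : ℤ)) ∈ F) :
    q1Interp ε u x = ∑ ξ ∈ F, cellMean ε u ξ * nodeFun ε ξ x := by
  classical
  set ι : (Fin n → Fin 2) → (Fin n → ℤ) := fun κ i => intPart (ε⁻¹ • x) i + ((κ i : ℕ) : ℤ)
  have hinj : Function.Injective ι := by
    intro κ κ' h
    ext i
    have := congrFun h i
    simpa [ι] using this
  rw [q1Interp_eq_sum]
  calc ∑ κ, vertexMean ε u x κ * vertexWeight ε x κ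
      = ∑ κ, cellMean ε u (ι κ) * nodeFun ε (ι κ) x :=
        Finset.sum_congr rfl fun κ _ => by rw [vertexWeight_eq_nodeFun]; rfl
    _ = ∑ ξ ∈ Finset.univ.image ι, cellMean ε u ξ * nodeFun ε ξ x :=
        (Finset.sum_image (f := fun ξ => cellMean ε u ξ * nodeFun ε ξ x) hinj.injOn).symm
    _ = _ := by
        refine Finset.sum_subset (fun ξ hξ => ?_) fun ξ _ hξ => ?_
        · obtain ⟨κ, -, rfl⟩ := Finset.mem_image.1 hξ
          exact hF κ
        · have : ∃ i, ξ i ≠ ⌊ε⁻¹ * x i⌋ ∧ ξ i ≠ ⌊ε⁻¹ * x i⌋ + 1 := by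
            by_contra! hcon
            apply hξ
            refine Finset.mem_image.2
              ⟨fun i => if ξ i = ⌊ε⁻¹ * x i⌋ then 0 else 1, Finset.mem_univ _, ?_⟩
            ext i
            by_cases hi : ξ i = ⌊ε⁻¹ * x i⌋
            · simp [ι, intPart, hi]
            · simp [ι, intPart, hcon i hi]
          obtain ⟨i, hi0, hi1⟩ := this
          have : nodeFun ε ξ x = 0 :=
            Finset.prod_eq_zero (Finset.mem_univ i) (hat_eq_zero_of_ne hi0 hi1)
          rw [this, mul_zero]

theorem exists_lipschitzWith_eqOn_q1Interp {n : ℕ} {ε : ℝ} (hε : 0 < ε) (u : Rn n → ℝ) (R : ℝ) :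
    ∃ (C : ℝ≥0) (g : Rn n → ℝ), LipschitzWith C g ∧ EqOn (q1Interp ε u) g (ball 0 R) := by
  -- On the ball the integer parts are at most `⌈ε⁻¹ R⌉` in absolute value, and a vertex adds at
  -- most 1; the last unit is slack.
  set N : ℤ := ⌈ε⁻¹ * R⌉ + 2
  set F : Finset (Fin n → ℤ) := Fintype.piFinset fun _ => Finset.Icc (-N) N
  refine ⟨Real.toNNReal ((∑ ξ ∈ F, |cellMean ε u ξ|) * (n * ε⁻¹)),
    fun x => ∑ ξ ∈ F, cellMean ε u ξ * nodeFun ε ξ x, ?_, ?_⟩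
  · refine LipschitzWith.of_dist_le_mul fun x y => ?_
    rw [Real.coe_toNNReal _ (by positivity), Real.dist_eq, ← Finset.sum_sub_distrib, dist_eq_norm,
      Finset.sum_mul, Finset.sum_mul]
    refine (Finset.abs_sum_le_sum_abs _ _).trans (Finset.sum_le_sum fun ξ _ => ?_)
    rw [← mul_sub, abs_mul, mul_assoc]
    gcongr
    exact abs_nodeFun_sub_le hε ξ x y
  · intro x hx
    refine q1Interp_eq_sum_nodeFun ε u x F fun κ => ?_
    simp only [F, Fintype.mem_piFinset, Finset.mem_Icc]
    intro i
    rw [mem_ball_zero_iff] at hx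
    have h1 : |ε⁻¹ * x i| ≤ ε⁻¹ * R := by
      rw [abs_mul, abs_of_pos (inv_pos.2 hε)]
      gcongr
      exact (PiLp.norm_apply_le x i).trans hx.le
    have h2 := abs_le.1 h1
    have h3 := Int.le_ceil (ε⁻¹ * R)
    have h4 : ⌊ε⁻¹ * x i⌋ ≤ ⌈ε⁻¹ * R⌉ := by
      exact_mod_cast (Int.floor_le _).trans (h2.2.trans h3)
    have h5 : -⌈ε⁻¹ * R⌉ ≤ ⌊ε⁻¹ * x i⌋ := by
      rw [Int.le_floor]; push_cast; linarith
    have h6 : (κ i : ℕ) ≤ 1 := Nat.lt_succ_iff.1 (κ i).2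
    simp only [intPart, PiLp.smul_apply, smul_eq_mul]
    omega

theorem continuous_q1Interp {n : ℕ} {ε : ℝ} (hε : 0 < ε) (u : Rn n → ℝ) :
    Continuous (q1Interp ε u) := by
  rw [continuous_iff_continuousAt]
  intro x
  obtain ⟨C, g, hg, hEq⟩ := exists_lipschitzWith_eqOn_q1Interp hε u (‖x‖ + 1)
  refine hg.continuous.continuousAt.congr ?_
  filter_upwards [isOpen_ball.mem_nhds (show x ∈ ball (0 : Rn n) (‖x‖ + 1) by simp)] with y hy
  exact (hEq hy).symm

/-- The vector of the partial derivatives of `𝒬_ε(u)`. -/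
noncomputable def q1Gradient {n : ℕ} (ε : ℝ) (u : Rn n → ℝ) (x : Rn n) : Rn n :=
  WithLp.toLp 2 fun i => lineDeriv ℝ (q1Interp ε u) x (EuclideanSpace.single i 1)

theorem measurable_q1Gradient {n : ℕ} {ε : ℝ} (hε : 0 < ε) (u : Rn n → ℝ) :
    Measurable (q1Gradient ε u) := by
  refine (PiLp.volume_preserving_toLp (Fin n)).measurable.comp (measurable_pi_lambda _ fun i => ?_)
  exact measurable_lineDeriv (continuous_q1Interp hε u)

/-- The integer part is right-continuous: a small move in a nonnegative direction stays in the same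
half-open cell, even from a face. -/
theorem floor_add_eventually (a b : ℝ) (hb : 0 ≤ b) :
    ∀ᶠ t in nhdsWithin (0 : ℝ) (Ioi 0), ⌊a + t * b⌋ = ⌊a⌋ := by
  have h1 : ∀ᶠ t in nhds (0 : ℝ), a + t * b < ⌊a⌋ + 1 :=
    (by fun_prop : Continuous fun t : ℝ => a + t * b).continuousAt.eventually_lt
      continuousAt_const (by simp)
  filter_upwards [nhdsWithin_le_nhds h1, self_mem_nhdsWithin] with t ht ht0
  rw [Int.floor_eq_iff]
  have : 0 ≤ t * b := mul_nonneg (le_of_lt ht0) hb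
  exact ⟨by linarith [Int.floor_le a], ht⟩

theorem abs_lineDeriv_q1Interp_le {n : ℕ} {ε : ℝ} (hε : 0 < ε) (u : Rn n → ℝ) (x : Rn n) (a : ℝ)
    (i : Fin n) : |lineDeriv ℝ (q1Interp ε u) x (EuclideanSpace.single i 1)| ≤
      n * ε⁻¹ * ∑ κ, |a - vertexMean ε u x κ| := by
  set e : Rn n := EuclideanSpace.single i 1 with he
  by_cases hd : LineDifferentiableAt ℝ (q1Interp ε u) x e
  swap
  -- Where the derivative does not exist, `lineDeriv` is 0 and the bound is trivial.
  · rw [lineDeriv_zero_of_not_lineDifferentiableAt hd, abs_zero]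
    positivity
  -- Right difference quotients suffice, and they only see the cell of `x`, where the vertex means
  -- are constant.
  have hlim := hd.hasLineDerivAt.tendsto_slope_zero_right
  refine le_of_tendsto hlim.abs ?_
  have hfl : ∀ᶠ t in nhdsWithin (0 : ℝ) (Ioi 0), ∀ j, ⌊ε⁻¹ * x j + t * (ε⁻¹ * e j)⌋ = ⌊ε⁻¹ * x j⌋ := by
    rw [Filter.eventually_all]
    intro j
    refine floor_add_eventually _ _ (mul_nonneg (inv_pos.2 hε).le ?_)
    simp only [he, PiLp.single_apply]
    split_ifs <;> norm_num
  filter_upwards [hfl, self_mem_nhdsWithin] with t ht ht0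
  have ht0' : 0 < t := ht0
  have hint : intPart (ε⁻¹ • (x + t • e)) = intPart (ε⁻¹ • x) := by
    ext j
    simp only [intPart, PiLp.smul_apply, PiLp.add_apply, smul_eq_mul]
    rw [← ht j]
    congr 1; ring
  have hvm : vertexMean ε u (x + t • e) = vertexMean ε u x := by
    ext κ; simp only [vertexMean, hint]
  -- The weights sum to 1 at both points, so the reference value `a` may be subtracted from every
  -- vertex mean.
  have h1 : q1Interp ε u (x + t • e) - q1Interp ε u x =
      ∑ κ, (vertexWeight ε x κ - vertexWeight ε (x + t • e) κ) * (a - vertexMean ε u x κ) := by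
    have h2 := sub_q1Interp_eq_sum ε u x a
    have h3 := sub_q1Interp_eq_sum ε u (x + t • e) a
    rw [hvm] at h3
    simp only [sub_mul, Finset.sum_sub_distrib]
    linarith
  have hnorm : ‖e‖ = 1 := by simp [he]
  rw [smul_eq_mul, abs_mul, abs_of_pos (inv_pos.2 ht0'), h1, inv_mul_le_iff₀ ht0', Finset.mul_sum,
    Finset.mul_sum]
  refine (Finset.abs_sum_le_sum_abs _ _).trans (Finset.sum_le_sum fun κ _ => ?_)
  rw [abs_mul, ← mul_assoc]
  gcongr
  rw [vertexWeight_eq_nodeFun, vertexWeight_eq_nodeFun, hint]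
  refine (abs_nodeFun_sub_le hε _ _ _).trans (le_of_eq ?_)
  simp [norm_smul, hnorm, abs_of_pos ht0']
  ring

theorem norm_q1Gradient_sq_le {n : ℕ} {ε : ℝ} (hε : 0 < ε) (u : Rn n → ℝ) (x : Rn n) (a : ℝ) :
    ‖q1Gradient ε u x‖ ^ 2 ≤
      (n * (n * ε⁻¹) ^ 2 * 2 ^ n) * ∑ κ, (a - vertexMean ε u x κ) ^ 2 := by
  rw [EuclideanSpace.norm_sq_eq]
  have h : ∀ i ∈ (Finset.univ : Finset (Fin n)), ‖q1Gradient ε u x i‖ ^ 2 ≤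
      (n * ε⁻¹) ^ 2 * (2 ^ n * ∑ κ, (a - vertexMean ε u x κ) ^ 2) := by
    intro i _
    have h1 := abs_lineDeriv_q1Interp_le hε u x a i
    have h2 : (∑ κ, |a - vertexMean ε u x κ|) ^ 2 ≤ 2 ^ n * ∑ κ, (a - vertexMean ε u x κ) ^ 2 := by
      refine (sq_sum_le_card_mul_sum_sq (s := Finset.univ)).trans (le_of_eq ?_)
      simp
    calc ‖q1Gradient ε u x i‖ ^ 2 ≤ (n * ε⁻¹ * ∑ κ, |a - vertexMean ε u x κ|) ^ 2 :=
          pow_le_pow_left₀ (norm_nonneg _) h1 2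
      _ = (n * ε⁻¹) ^ 2 * (∑ κ, |a - vertexMean ε u x κ|) ^ 2 := by ring
      _ ≤ _ := by gcongr
  refine (Finset.sum_le_sum h).trans (le_of_eq ?_)
  simp; ring

theorem lintegral_norm_q1Gradient_sq_le {n : ℕ} (hn : 0 < n) {s : ℝ} (hs : 0 < s) {ε : ℝ}
    (hε : 0 < ε) {u : Rn n → ℝ} (hu : Measurable u) :
    ∫⁻ x, ENNReal.ofReal (‖q1Gradient ε u x‖ ^ 2) ≤
      ENNReal.ofReal ((n * n ^ 2 * 2 ^ n * (2 ^ n * (3 * √n) ^ ((n : ℝ) + 2 * s))) *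
        (ε ^ (s - 1)) ^ 2) * gagliardo s univ u := by
  calc ∫⁻ x, ENNReal.ofReal (‖q1Gradient ε u x‖ ^ 2)
      ≤ ∫⁻ x, ENNReal.ofReal (n * (n * ε⁻¹) ^ 2 * 2 ^ n) *
          ∑ κ, ENNReal.ofReal ((u x - vertexMean ε u x κ) ^ 2) := by
        refine lintegral_mono fun x => ?_
        rw [← ENNReal.ofReal_sum_of_nonneg fun κ _ => sq_nonneg _,
          ← ENNReal.ofReal_mul (by positivity)]
        exact ENNReal.ofReal_le_ofReal (norm_q1Gradient_sq_le hε u x (u x))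
    _ ≤ _ := by
        rw [lintegral_const_mul' _ _ ENNReal.ofReal_ne_top]
        refine (mul_le_mul_right (lintegral_sum_sq_sub_vertexMean_le hn hs hε hu) _).trans
          (le_of_eq ?_)
        rw [← mul_assoc, ← ENNReal.ofReal_mul (by positivity)]
        congr 2
        rw [Real.rpow_sub_one hε.ne', div_pow, ← Real.rpow_natCast (ε ^ s), ← Real.rpow_mul hε.le,
          mul_comm 2 s]
        push_cast
        field_simp

/-- On a ball containing the support of the test function the interpolate agrees with a globally
Lipschitz function, for which integration by parts is available. The `L²` hypothesis serves only for
local integrability of the gradient. -/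
theorem hasWeakGradientOn_q1Interp {n : ℕ} {ε : ℝ} (hε : 0 < ε) (u : Rn n → ℝ) {U : Set (Rn n)}
    (hG : eLpNorm (q1Gradient ε u) 2 volume < ⊤) :
    HasWeakGradientOn U (q1Interp ε u) (q1Gradient ε u) := by
  have hmem : MemLp (q1Gradient ε u) 2 volume :=
    ⟨(measurable_q1Gradient hε u).aestronglyMeasurable, hG⟩
  refine ⟨(continuous_q1Interp hε u).locallyIntegrable.locallyIntegrableOn U,
    (hmem.locallyIntegrable (by norm_num)).locallyIntegrableOn U, fun ψ hψ hψc hψU i => ?_⟩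
  set e : Rn n := EuclideanSpace.single i 1 with he
  obtain ⟨R, hR⟩ := hψc.isCompact.isBounded.subset_ball (0 : Rn n)
  obtain ⟨C, g, hg, hEq⟩ := exists_lipschitzWith_eqOn_q1Interp hε u R
  obtain ⟨D, hD⟩ := ContDiff.lipschitzWith_of_hasCompactSupport hψc hψ (by simp)
  have hψ0 : ∀ x, x ∉ tsupport ψ → ψ x = 0 := fun x hx => image_eq_zero_of_notMem_tsupport hx
  have hdψ0 : ∀ x, x ∉ tsupport ψ → fderiv ℝ ψ x = 0 := fun x hx =>
    Function.notMem_support.1 fun h => hx (support_fderiv_subset ℝ h)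
  rw [setIntegral_eq_integral_of_forall_compl_eq_zero
      (fun x hx => by rw [hdψ0 x fun h => hx (hψU h)]; simp),
    setIntegral_eq_integral_of_forall_compl_eq_zero
      (fun x hx => by rw [hψ0 x fun h => hx (hψU h)]; simp)]
  have h1 : ∫ x, q1Interp ε u x * fderiv ℝ ψ x e = - ∫ x, lineDeriv ℝ ψ x (-e) * g x := by
    rw [← integral_neg]
    refine integral_congr_ae (Filter.Eventually.of_forall fun x => ?_)
    simp only
    rw [lineDeriv_neg, (hψ.differentiable (by simp) x).lineDeriv_eq_fderiv]
    by_cases hx : x ∈ tsupport ψ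
    · rw [hEq (hR hx)]; ring
    · rw [hdψ0 x hx]; simp
  rw [h1, ← hg.integral_lineDeriv_mul_eq hD hψc]
  congr 1
  refine integral_congr_ae (Filter.Eventually.of_forall fun x => ?_)
  simp only
  by_cases hx : x ∈ tsupport ψ
  · congr 1
    refine Filter.EventuallyEq.lineDeriv_eq ?_
    filter_upwards [isOpen_ball.mem_nhds (hR hx)] with y hy
    exact (hEq hy).symm
  · rw [hψ0 x hx]; simp

/-! ### Height functions and boundary charts. -/

/-- A Lipschitz function that grows with unit speed in the unit direction `e`; its zero set is
a Lipschitz graph over `e^⊥`. -/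
structure IsHeight {n : ℕ} (L : ℝ≥0) (e : Rn n) (h : Rn n → ℝ) : Prop where
  norm_eq : ‖e‖ = 1
  lipschitz : LipschitzWith L h
  add_smul : ∀ (y : Rn n) (t : ℝ), h (y + t • e) = h y + t

theorem lipschitzWith_sub_inner_smul {n : ℕ} {e : Rn n} (he : ‖e‖ = 1) :
    LipschitzWith 2 fun y : Rn n => y - ⟪e, y⟫ • e := by
  refine LipschitzWith.of_dist_le_mul fun x y => ?_
  rw [dist_eq_norm, dist_eq_norm]
  have h1 : x - ⟪e, x⟫ • e - (y - ⟪e, y⟫ • e) = (x - y) - ⟪e, x - y⟫ • e := by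
    rw [inner_sub_right, sub_smul]; abel
  rw [h1]
  refine (norm_sub_le _ _).trans ?_
  have h2 : |⟪e, x - y⟫| ≤ ‖x - y‖ := by
    simpa [he] using abs_real_inner_le_norm e (x - y)
  rw [norm_smul, he, mul_one, Real.norm_eq_abs]
  push_cast
  linarith

theorem isHeight_of_graph {n : ℕ} {e : Rn n} {γ : Rn n → ℝ} {L : ℝ≥0} (he : ‖e‖ = 1)
    (hγ : LipschitzWith L γ) :
    IsHeight (1 + L * 2) e fun y => ⟪e, y⟫ - γ (y - ⟪e, y⟫ • e) where
  norm_eq := he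
  lipschitz := by
    have h1 : LipschitzWith 1 fun y : Rn n => ⟪e, y⟫ := by
      refine LipschitzWith.of_dist_le_mul fun x y => ?_
      rw [Real.dist_eq, ← inner_sub_right, dist_eq_norm]
      simpa [he] using abs_real_inner_le_norm e (x - y)
    exact h1.sub (hγ.comp (lipschitzWith_sub_inner_smul he))
  add_smul y t := by
    have h1 : ⟪e, y + t • e⟫ = ⟪e, y⟫ + t := by
      rw [inner_add_right, inner_smul_right, real_inner_self_eq_norm_sq, he]; simp
    have h2 : y + t • e - (⟪e, y⟫ + t) • e = y - ⟪e, y⟫ • e := by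
      rw [_root_.add_smul]; abel
    simp only [h1, h2]
    ring

theorem IsHeight.add_const {n : ℕ} {L : ℝ≥0} {e : Rn n} {h : Rn n → ℝ} (hh : IsHeight L e h)
    (c : ℝ) : IsHeight L e fun y => h y + c where
  norm_eq := hh.norm_eq
  lipschitz := by
    refine LipschitzWith.of_dist_le_mul fun x y => ?_
    rw [dist_add_right]
    exact hh.lipschitz.dist_le_mul x y
  add_smul y t := by rw [hh.add_smul]; ring

/-- Near `x`, the set `Ω` is the positivity set of the height function `h`. -/
structure IsBoundaryChart {n : ℕ} (Ω : Set (Rn n)) (x : Rn n) (L : ℝ≥0) (e : Rn n)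
    (h : Rn n → ℝ) (r : ℝ) : Prop where
  height : IsHeight L e h
  pos : 0 < r
  mem_iff : ∀ y ∈ ball x r, y ∈ Ω ↔ 0 < h y

theorem HasLipschitzBoundary.exists_chart {n : ℕ} {Ω : Set (Rn n)} (hΩ : HasLipschitzBoundary Ω)
    {x : Rn n} (hx : x ∈ frontier Ω) : ∃ L e h r, IsBoundaryChart Ω x L e h r := by
  obtain ⟨e, γ, L, r, he, hγ, hr, hmem⟩ := hΩ x hx
  refine ⟨_, e, _, r, isHeight_of_graph he hγ, hr, fun y hy => ?_⟩
  rw [hmem y hy, sub_pos]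

theorem IsBoundaryChart.eq_zero_of_mem_frontier {n : ℕ} {Ω : Set (Rn n)} (hΩ : IsOpen Ω)
    {x : Rn n} {L : ℝ≥0} {e : Rn n} {h : Rn n → ℝ} {r : ℝ} (hc : IsBoundaryChart Ω x L e h r)
    {z : Rn n} (hz : z ∈ frontier Ω) (hzr : z ∈ ball x r) : h z = 0 := by
  rw [hΩ.frontier_eq] at hz
  refine le_antisymm (not_lt.1 fun hlt => hz.2 ((hc.mem_iff z hzr).2 hlt)) ?_
  have h1 : z ∈ closure (ball x r ∩ Ω) :=
    isOpen_ball.inter_closure ⟨hzr, hz.1⟩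
  have h2 : closure (ball x r ∩ Ω) ⊆ {y | 0 ≤ h y} :=
    closure_minimal (fun y hy => ((hc.mem_iff y hy.1).1 hy.2).le)
      (isClosed_le continuous_const hc.height.lipschitz.continuous)
  exact h2 h1

/-! ### The mass of a boundary layer. -/

/-- The bound `M w^s E` passes from `2w` to `w < 1/2` because `q M 2^s + c ≤ M` and `w^(2s) ≤ w^s`.
Doubling stops once `w ≥ 1/2`, where `G w ≤ E` is enough since `M ≥ 2^s`. -/
theorem le_of_doubling_recursion {s q c : ℝ} (hs : 0 < s) (hq : 0 < q) (hq1 : q * 2 ^ s < 1)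
    (hc : 0 ≤ c) {G : ℝ → ℝ} {E : ℝ} (hE : 0 ≤ E) (hGE : ∀ w, 0 < w → G w ≤ E)
    (hG : ∀ w, 0 < w → G w ≤ q * G (2 * w) + c * w ^ (2 * s) * E) {w : ℝ} (hw : 0 < w) :
    G w ≤ (2 ^ s + c / (1 - q * 2 ^ s)) * w ^ s * E := by
  set M := 2 ^ s + c / (1 - q * 2 ^ s) with hM
  have hden : 0 < 1 - q * 2 ^ s := by linarith
  have h2s : (0 : ℝ) < 2 ^ s := by positivity
  have hMle : 2 ^ s ≤ M := by
    have : 0 ≤ c / (1 - q * 2 ^ s) := by positivity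
    linarith
  have hMc : q * M * 2 ^ s + c ≤ M := by
    have h1 : c = c / (1 - q * 2 ^ s) * (1 - q * 2 ^ s) := by field_simp
    have h2 : c ≤ M * (1 - q * 2 ^ s) := by
      rw [h1]; gcongr; linarith
    linarith
  have key : ∀ k : ℕ, ∀ w : ℝ, 0 < w → 1 / 2 ≤ 2 ^ k * w → G w ≤ M * w ^ s * E := by
    intro k
    induction k with
    | zero =>
      intro w hw hk
      refine (hGE w hw).trans (le_mul_of_one_le_left hE ?_)
      calc (1 : ℝ) = 2 ^ s * (1 / 2) ^ s := by
            rw [← Real.mul_rpow (by norm_num) (by norm_num)]; norm_num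
        _ ≤ M * w ^ s := by
            gcongr
            simpa using hk
    | succ k ih =>
      intro w hw hk
      rcases le_or_gt (1 / 2) w with h | h
      · have h1 : (1 : ℝ) / 2 ≤ 2 ^ k * w :=
          h.trans (le_mul_of_one_le_left hw.le (one_le_pow₀ (by norm_num)))
        exact ih w hw h1
      · have h1 := ih (2 * w) (by positivity) (by rw [pow_succ] at hk; linarith)
        have h3 : w ^ (2 * s) ≤ w ^ s :=
          Real.rpow_le_rpow_of_exponent_ge hw (by linarith) (by linarith)
        rw [Real.mul_rpow (by norm_num) hw.le] at h1
        calc G w ≤ q * (M * (2 ^ s * w ^ s) * E) + c * w ^ s * E := by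
              refine (hG w hw).trans ?_
              gcongr
          _ = (q * M * 2 ^ s + c) * w ^ s * E := by ring
          _ ≤ _ := by gcongr
  obtain ⟨k, hk⟩ := pow_unbounded_of_one_lt (1 / w) (one_lt_two : (1 : ℝ) < 2)
  refine key k w hw ?_
  rw [div_lt_iff₀ hw] at hk
  linarith

theorem sq_le_mul_sq_add {l a b : ℝ} (hl : 1 < l) :
    a ^ 2 ≤ l * b ^ 2 + l / (l - 1) * (a - b) ^ 2 := by
  have h0 : 0 < l - 1 := by linarith
  have h1 : l * b ^ 2 + l / (l - 1) * (a - b) ^ 2 - a ^ 2 =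
      ((l - 1) * b - (a - b)) ^ 2 / (l - 1) := by
    field_simp; ring
  have : 0 ≤ ((l - 1) * b - (a - b)) ^ 2 / (l - 1) := by positivity
  linarith

/-- The strip `[0, w)` is compared with `[w, 2w)` through translation by `w e`, and the translation
estimate controls the error. A weighted Young inequality yields the recursion of
`le_of_doubling_recursion`. -/
theorem exists_lintegral_strip_le {n : ℕ} {s : ℝ} (hs0 : 0 < s) (hs1 : s < 1) :
    ∃ M : ℝ, 0 < M ∧ ∀ u : Rn n → ℝ, Measurable u → ∀ (L : ℝ≥0) (e : Rn n) (h : Rn n → ℝ),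
      IsHeight L e h → ∀ w : ℝ, 0 < w →
      ∫⁻ x in {x | 0 ≤ h x ∧ h x < w}, ENNReal.ofReal (u x ^ 2) ≤
        ENNReal.ofReal (M * w ^ s) * hsEnergy s univ u := by
  obtain ⟨C, hC0, hC⟩ := exists_lintegral_sq_sub_translate_le (n := n) hs0
  set p : ℝ := (2 ^ s)⁻¹ with hp
  have h2s : (0 : ℝ) < 2 ^ s := by positivity
  have hp1 : p < 1 := inv_lt_one_of_one_lt₀ (Real.one_lt_rpow (by norm_num) hs0)
  have hp2 : 1 / 2 < p := by
    rw [hp, one_div]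
    refine inv_strictAnti₀ h2s ?_
    calc (2 : ℝ) ^ s < 2 ^ (1 : ℝ) := Real.rpow_lt_rpow_of_exponent_lt (by norm_num) hs1
      _ = 2 := by simp
  set q : ℝ := (1 / 2 + p) / 2 with hq
  have hq1 : q < p := by linarith
  have hq2 : 1 / 2 < q := by linarith
  have hqs : q * 2 ^ s < 1 := by
    calc q * 2 ^ s < p * 2 ^ s := by gcongr
      _ = 1 := by rw [hp]; field_simp
  set l : ℝ := q / (1 - q) with hl
  have hq' : 0 < 1 - q := by linarith
  have hl1 : 1 < l := by rw [hl, one_lt_div hq']; linarith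
  set c : ℝ := (1 - q) * (l / (l - 1) * C) with hc
  have hl0 : 0 < l - 1 := by linarith
  have hc0 : 0 ≤ c := by positivity
  have hden : 0 < 1 - q * 2 ^ s := by linarith
  refine ⟨2 ^ s + c / (1 - q * 2 ^ s), by positivity, fun u hu L e h hh w hw => ?_⟩
  by_cases hE : hsEnergy s univ u = ⊤
  · rw [hE, ENNReal.mul_top]
    · exact le_top
    · rw [ne_eq, ENNReal.ofReal_eq_zero, not_le]; positivity
  have hgE : ∀ S : Set (Rn n), ∫⁻ x in S, ENNReal.ofReal (u x ^ 2) ≤ hsEnergy s univ u := by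
    intro S
    refine (setLIntegral_le_lintegral _ _).trans ?_
    unfold hsEnergy
    rw [Measure.restrict_univ]
    exact le_self_add
  have hfin : ∀ S : Set (Rn n), ∫⁻ x in S, ENNReal.ofReal (u x ^ 2) ≠ ⊤ := fun S =>
    ((hgE S).trans_lt (lt_top_iff_ne_top.2 hE)).ne
  have hcont := hh.lipschitz.continuous
  have hms : ∀ a b : ℝ, MeasurableSet {x | a ≤ h x ∧ h x < b} := fun a b =>
    (measurableSet_le measurable_const hcont.measurable).inter
      (measurableSet_lt hcont.measurable measurable_const)
  set G : ℝ → ℝ := fun w =>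
    (∫⁻ x in {x | 0 ≤ h x ∧ h x < w}, ENNReal.ofReal (u x ^ 2)).toReal with hGdef
  have hrec : ∀ w, 0 < w → G w ≤ q * G (2 * w) + c * w ^ (2 * s) * (hsEnergy s univ u).toReal := by
    intro w hw
    set b := ∫⁻ x in {x | w ≤ h x ∧ h x < 2 * w}, ENNReal.ofReal (u x ^ 2) with hb
    have hunion : G (2 * w) = G w + b.toReal := by
      rw [hGdef]
      simp only
      rw [← ENNReal.toReal_add (hfin _) (hfin _), ← lintegral_union (hms _ _)]
      · congr 3
        ext x
        simp only [mem_ofPred_eq, mem_union]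
        constructor
        · rintro ⟨h1, h2⟩
          rcases lt_or_ge (h x) w with h3 | h3
          · exact Or.inl ⟨h1, h3⟩
          · exact Or.inr ⟨h3, h2⟩
        · rintro (⟨h1, h2⟩ | ⟨h1, h2⟩)
          · exact ⟨h1, by linarith⟩
          · exact ⟨by linarith, h2⟩
      · rw [disjoint_left]
        rintro x ⟨_, h2⟩ ⟨h3, _⟩
        linarith
    have hshift : ∫⁻ x in {x | 0 ≤ h x ∧ h x < w}, ENNReal.ofReal (u (x + w • e) ^ 2) = b := by
      rw [hb, ← lintegral_indicator (hms _ _), ← lintegral_indicator (hms _ _),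
        ← lintegral_add_right_eq_self ({x | w ≤ h x ∧ h x < 2 * w}.indicator
          fun x => ENNReal.ofReal (u x ^ 2)) (w • e)]
      refine lintegral_congr fun x => ?_
      simp only [indicator, mem_ofPred_eq, hh.add_smul]
      congr 1
      exact propext ⟨fun ⟨h1, h2⟩ => ⟨by linarith, by linarith⟩,
        fun ⟨h1, h2⟩ => ⟨by linarith, by linarith⟩⟩
    have hG1 : ∫⁻ x in {x | 0 ≤ h x ∧ h x < w}, ENNReal.ofReal (u x ^ 2) ≤
        ENNReal.ofReal l * b +
          ENNReal.ofReal (l / (l - 1) * C * w ^ (2 * s)) * hsEnergy s univ u := by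
      calc ∫⁻ x in {x | 0 ≤ h x ∧ h x < w}, ENNReal.ofReal (u x ^ 2)
          ≤ ∫⁻ x in {x | 0 ≤ h x ∧ h x < w},
              (ENNReal.ofReal l * ENNReal.ofReal (u (x + w • e) ^ 2) +
              ENNReal.ofReal (l / (l - 1)) * ENNReal.ofReal ((u x - u (x + w • e)) ^ 2)) := by
            refine lintegral_mono fun x => ?_
            rw [← ENNReal.ofReal_mul (by positivity), ← ENNReal.ofReal_mul (by positivity),
              ← ENNReal.ofReal_add (by positivity) (by positivity)]
            exact ENNReal.ofReal_le_ofReal (sq_le_mul_sq_add hl1)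
        _ = ENNReal.ofReal l * b + ENNReal.ofReal (l / (l - 1)) *
              ∫⁻ x in {x | 0 ≤ h x ∧ h x < w}, ENNReal.ofReal ((u x - u (x + w • e)) ^ 2) := by
            rw [lintegral_add_left (by fun_prop), lintegral_const_mul' _ _ ENNReal.ofReal_ne_top,
              lintegral_const_mul' _ _ ENNReal.ofReal_ne_top, hshift]
        _ ≤ _ := by
            rw [mul_assoc (l / (l - 1)), ENNReal.ofReal_mul (p := l / (l - 1)) (by positivity),
              mul_assoc]
            refine add_le_add le_rfl (mul_le_mul_right ?_ _)
            refine (setLIntegral_le_lintegral _ _).trans ((hC u hu (w • e)).trans ?_)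
            rw [norm_smul, hh.norm_eq, mul_one, Real.norm_eq_abs, abs_of_pos hw]
            gcongr
            exact le_add_self
    have hG2 : G w ≤ l * b.toReal + l / (l - 1) * C * w ^ (2 * s) * (hsEnergy s univ u).toReal := by
      have h1 := ENNReal.toReal_mono (ENNReal.add_ne_top.2
        ⟨ENNReal.mul_ne_top ENNReal.ofReal_ne_top (hfin _),
          ENNReal.mul_ne_top ENNReal.ofReal_ne_top hE⟩) hG1
      rwa [ENNReal.toReal_add (ENNReal.mul_ne_top ENNReal.ofReal_ne_top (hfin _))
        (ENNReal.mul_ne_top ENNReal.ofReal_ne_top hE), ENNReal.toReal_mul, ENNReal.toReal_mul,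
        ENNReal.toReal_ofReal (by positivity), ENNReal.toReal_ofReal (by positivity)] at h1
    have hlq : (1 - q) * l = q := by rw [hl]; field_simp
    -- Only the fraction `1 - q` of the strip is moved; as `(1 - q) l = q`, both halves of the
    -- double strip then carry the coefficient `q`.
    calc G w = q * G w + (1 - q) * G w := by ring
      _ ≤ q * G w + (1 - q) * (l * b.toReal +
          l / (l - 1) * C * w ^ (2 * s) * (hsEnergy s univ u).toReal) := by gcongr
      _ = q * G w + ((1 - q) * l) * b.toReal + c * w ^ (2 * s) * (hsEnergy s univ u).toReal := by
          rw [hc]; ring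
      _ = _ := by rw [hlq, hunion]; ring
  have hfinal := le_of_doubling_recursion hs0 (by linarith) hqs hc0
    (ENNReal.toReal_nonneg (a := hsEnergy s univ u))
    (fun w _ => ENNReal.toReal_mono hE (hgE _)) hrec hw
  rw [← ENNReal.ofReal_toReal (hfin {x | 0 ≤ h x ∧ h x < w}), ← ENNReal.ofReal_toReal hE,
    ← ENNReal.ofReal_mul (by positivity)]
  exact ENNReal.ofReal_le_ofReal hfinal

/-- The radius `ρ` is free because foldings need a cover by balls smaller than the chart balls. -/
theorem exists_finite_charts {n : ℕ} {Ω : Set (Rn n)} (hΩ_bdd : Bornology.IsBounded Ω)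
    (hΩ_lip : HasLipschitzBoundary Ω) (ρ : Rn n → ℝ≥0 → ℝ → ℝ)
    (hρ : ∀ x L r, 0 < r → 0 < ρ x L r) :
    ∃ (t : Finset (Rn n)) (L : Rn n → ℝ≥0) (e : Rn n → Rn n) (h : Rn n → Rn n → ℝ) (r : Rn n → ℝ),
      (∀ x ∈ t, x ∈ frontier Ω ∧ IsBoundaryChart Ω x (L x) (e x) (h x) (r x)) ∧
      frontier Ω ⊆ ⋃ x ∈ t, ball x (ρ x (L x) (r x)) := by
  have h1 : ∀ x : Rn n, ∃ (L : ℝ≥0) (e : Rn n) (h : Rn n → ℝ) (r : ℝ),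
      x ∈ frontier Ω → IsBoundaryChart Ω x L e h r := by
    intro x
    by_cases hx : x ∈ frontier Ω
    · obtain ⟨L, e, h, r, hc⟩ := hΩ_lip.exists_chart hx
      exact ⟨L, e, h, r, fun _ => hc⟩
    · exact ⟨0, 0, 0, 0, fun h => absurd h hx⟩
  choose L e h r hc using h1
  have hcomp : IsCompact (frontier Ω) :=
    isCompact_of_isClosed_isBounded isClosed_frontier
      (hΩ_bdd.closure.subset frontier_subset_closure)
  obtain ⟨t, ht, hcov⟩ := hcomp.elim_nhds_subcover (fun x => ball x (ρ x (L x) (r x)))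
    (fun x hx => ball_mem_nhds x (hρ x _ _ (hc x hx).pos))
  exact ⟨t, L, e, h, r, fun x hx => ⟨ht x hx, hc x (ht x hx)⟩, hcov⟩

theorem exists_finite_heights {n : ℕ} {Ω : Set (Rn n)} (hΩ : IsOpen Ω)
    (hΩ_bdd : Bornology.IsBounded Ω) (hΩ_lip : HasLipschitzBoundary Ω) :
    ∃ (t : Finset (Rn n)) (L : Rn n → ℝ≥0) (e : Rn n → Rn n) (h : Rn n → Rn n → ℝ),
      (∀ x ∈ t, IsHeight (L x) (e x) (h x)) ∧ frontier Ω ⊆ ⋃ x ∈ t, {y | h x y = 0} := by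
  obtain ⟨t, L, e, h, r, hc, hcov⟩ := exists_finite_charts hΩ_bdd hΩ_lip (fun _ _ r => r)
    (fun _ _ _ hr => hr)
  refine ⟨t, L, e, h, fun x hx => (hc x hx).2.height, fun z hz => ?_⟩
  obtain ⟨x, hx, hzx⟩ := mem_iUnion₂.1 (hcov hz)
  exact mem_iUnion₂.2 ⟨x, hx, (hc x hx).2.eq_zero_of_mem_frontier hΩ hz hzx⟩

theorem exists_lintegral_thickening_frontier_le {n : ℕ} {Ω : Set (Rn n)} (hΩ : IsOpen Ω)
    (hΩ_bdd : Bornology.IsBounded Ω) (hΩ_lip : HasLipschitzBoundary Ω) {s : ℝ} (hs0 : 0 < s)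
    (hs1 : s < 1) :
    ∃ M : ℝ, 0 ≤ M ∧ ∀ u : Rn n → ℝ, Measurable u → ∀ δ : ℝ, 0 < δ →
      ∫⁻ x in thickening δ (frontier Ω), ENNReal.ofReal (u x ^ 2) ≤
        ENNReal.ofReal (M * δ ^ s) * hsEnergy s univ u := by
  obtain ⟨M, hM0, hM⟩ := exists_lintegral_strip_le (n := n) hs0 hs1
  obtain ⟨t, L, e, h, hh, hcov⟩ := exists_finite_heights hΩ hΩ_bdd hΩ_lip
  refine ⟨∑ x ∈ t, M * (2 * (L x + 1 : ℝ)) ^ s, by positivity, fun u hu δ hδ => ?_⟩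
  -- Near a zero of `h` one has `|h| ≤ L δ`. Using `L + 1` keeps the inequality strict and the width
  -- positive when `L = 0`; adding `(L + 1) δ` to `h` makes the strip start at 0.
  have hsub : thickening δ (frontier Ω) ⊆
      ⋃ x ∈ t, {y | 0 ≤ h x y + (L x + 1) * δ ∧ h x y + (L x + 1) * δ < 2 * (L x + 1) * δ} := by
    intro y hy
    obtain ⟨z, hz, hyz⟩ := mem_thickening_iff.1 hy
    obtain ⟨x, hx, hzx⟩ := mem_iUnion₂.1 (hcov hz)
    refine mem_iUnion₂.2 ⟨x, hx, ?_⟩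
    have h1 := (hh x hx).lipschitz.dist_le_mul y z
    rw [show h x z = 0 from hzx, Real.dist_eq, sub_zero] at h1
    have h2 : |h x y| < (L x + 1) * δ := by
      have h3 : (L x : ℝ) * dist y z ≤ L x * δ := by gcongr
      linarith
    have h3 := abs_lt.1 h2
    exact ⟨by linarith, by linarith⟩
  calc ∫⁻ x in thickening δ (frontier Ω), ENNReal.ofReal (u x ^ 2)
      ≤ ∑ x ∈ t, ∫⁻ y in {y | 0 ≤ h x y + (L x + 1) * δ ∧
          h x y + (L x + 1) * δ < 2 * (L x + 1) * δ}, ENNReal.ofReal (u y ^ 2) := by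
        refine (lintegral_mono_set hsub).trans ?_
        rw [← lintegral_finsetSum_measure]
        refine lintegral_mono' ?_ le_rfl
        refine Measure.le_iff.2 fun A hA => ?_
        rw [Measure.restrict_apply hA, Measure.finsetSum_apply, inter_iUnion₂]
        refine (measure_biUnion_finset_le _ _).trans (Finset.sum_le_sum fun x _ => ?_)
        rw [Measure.restrict_apply hA]
    _ ≤ ∑ x ∈ t, ENNReal.ofReal (M * (2 * (L x + 1) * δ) ^ s) * hsEnergy s univ u :=
        Finset.sum_le_sum fun x hx => hM u hu (L x) (e x) _ ((hh x hx).add_const _) _ (by positivity)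
    _ = _ := by
        rw [← Finset.sum_mul, ← ENNReal.ofReal_sum_of_nonneg fun x _ => by positivity,
          Finset.sum_mul]
        congr 2
        refine Finset.sum_congr rfl fun x _ => ?_
        rw [Real.mul_rpow (by positivity) hδ.le]; ring

/-! ### Surface measure of Lipschitz graphs and the trace estimate. -/

/-- `G` sends `v ∈ e^⊥` to `v - h(v) e` and `p` is the orthogonal projection, in coordinates. The
parameters live in `Fin m → ℝ`, where Hausdorff measure is exactly Lebesgue measure. -/
theorem IsHeight.exists_parametrization {n : ℕ} {L : ℝ≥0} {e : Rn n} {h : Rn n → ℝ}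
    (hh : IsHeight L e h) :
    ∃ (m : ℕ) (K : ℝ≥0) (G : (Fin m → ℝ) → Rn n) (p : Rn n → Fin m → ℝ), m + 1 = n ∧
      LipschitzWith K G ∧ LipschitzWith 2 p ∧ ∀ x, h x = 0 → G (p x) = x := by
  set W : Submodule ℝ (Rn n) := (ℝ ∙ e)ᗮ with hW
  set m := Module.finrank ℝ W with hm
  have he : e ≠ 0 := by
    intro h0
    have := hh.norm_eq
    simp [h0] at this
  have hmn : m + 1 = n := by
    have h1 := (ℝ ∙ e).finrank_add_finrank_orthogonal
    rw [finrank_span_singleton he, finrank_euclideanSpace_fin] at h1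
    rw [← h1, add_comm]
  let A : W ≃ₗᵢ[ℝ] EuclideanSpace ℝ (Fin m) := (stdOrthonormalBasis ℝ W).repr
  have hproj : ∀ x : Rn n, x - ⟪e, x⟫ • e ∈ W := by
    intro x
    rw [hW, Submodule.mem_orthogonal_singleton_iff_inner_right, inner_sub_right,
      inner_smul_right, real_inner_self_eq_norm_sq, hh.norm_eq]
    ring
  let G : (Fin m → ℝ) → Rn n := fun v =>
    (A.symm (WithLp.toLp 2 v) : Rn n) - h (A.symm (WithLp.toLp 2 v) : Rn n) • e
  let p : Rn n → Fin m → ℝ := fun x => WithLp.ofLp (A ⟨_, hproj x⟩)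
  have hι : LipschitzWith _ fun v : Fin m → ℝ => (A.symm (WithLp.toLp 2 v) : Rn n) :=
    (LipschitzWith.subtype_val (W : Set (Rn n))).comp
      (A.symm.lipschitz.comp (PiLp.lipschitzWith_toLp 2 fun _ : Fin m => ℝ))
  have hs : LipschitzWith 1 fun t : ℝ => t • e := by
    refine LipschitzWith.of_dist_le_mul fun t t' => ?_
    rw [dist_eq_norm, ← sub_smul, norm_smul, hh.norm_eq, dist_eq_norm]
    simp
  refine ⟨m, _, G, p, hmn, hι.sub (hs.comp (hh.lipschitz.comp hι)), ?_, ?_⟩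
  · refine LipschitzWith.of_dist_le_mul fun x y => ?_
    have h1 := (PiLp.lipschitzWith_ofLp 2 fun _ : Fin m => ℝ).dist_le_mul
      (A ⟨_, hproj x⟩) (A ⟨_, hproj y⟩)
    rw [A.dist_map, Subtype.dist_eq] at h1
    have h2 := (lipschitzWith_sub_inner_smul hh.norm_eq).dist_le_mul x y
    simp only [NNReal.coe_one, one_mul] at h1
    exact h1.trans h2
  · intro x hx
    have h1 : h (x - ⟪e, x⟫ • e) = - ⟪e, x⟫ := by
      rw [sub_eq_add_neg, ← neg_smul, hh.add_smul, hx, zero_add]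
    simp only [G, p, WithLp.toLp_ofLp, LinearIsometryEquiv.symm_apply_apply, h1]
    simp

theorem IsHeight.exists_hausdorffMeasure_le {n : ℕ} {L : ℝ≥0} {e : Rn n} {h : Rn n → ℝ}
    (hh : IsHeight L e h) :
    ∃ C : ℝ, 0 ≤ C ∧ ∀ (y : Rn n) (r : ℝ), 0 ≤ r →
      μH[(n : ℝ) - 1] ({x | h x = 0} ∩ closedBall y r) ≤ ENNReal.ofReal (C * r ^ (n - 1)) := by
  obtain ⟨m, K, G, p, hmn, hG, hp, hGp⟩ := hh.exists_parametrization
  -- `p` is 2-Lipschitz, so the parameters fill at most a cube of side `4r`, and `G` multiplies its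
  -- measure by at most `K ^ m`.
  refine ⟨K ^ m * 4 ^ m, by positivity, fun y r hr => ?_⟩
  have hnm : (n : ℝ) - 1 = m := by rw [← hmn]; simp
  have hnm' : n - 1 = m := by omega
  rw [hnm, hnm']
  have hsub : {x | h x = 0} ∩ closedBall y r ⊆ G '' closedBall (p y) (2 * r) := by
    rintro x ⟨hx, hxy⟩
    refine ⟨p x, ?_, hGp x hx⟩
    rw [mem_closedBall] at hxy ⊢
    refine (hp.dist_le_mul x y).trans ?_
    push_cast
    linarith
  refine (measure_mono hsub).trans ((hG.hausdorffMeasure_image_le (by positivity) _).trans ?_)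
  have h1 : (μH[(m : ℝ)] : Measure (Fin m → ℝ)) = volume := by
    simpa using hausdorffMeasure_pi_real (ι := Fin m)
  rw [h1, Real.volume_pi_closedBall _ (by positivity), ENNReal.rpow_natCast, Fintype.card_fin,
    ← ENNReal.ofReal_coe_nnreal, ← ENNReal.ofReal_pow (by positivity),
    ← ENNReal.ofReal_mul (by positivity)]
  refine le_of_eq ?_
  congr 1
  rw [mul_assoc, ← mul_pow]
  ring

/-- The constant is left unspecified because it plays no role in Lipschitz image bounds and null
sets. -/
theorem volume_eq_smul_hausdorffMeasure (n : ℕ) :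
    ∃ c : ℝ≥0∞, (volume : Measure (Rn n)) = c • μH[(n : ℝ)] := by
  have h : Measure.IsAddHaarMeasure (μH[(n : ℝ)] : Measure (Rn n)) := by
    simpa using isAddHaarMeasure_hausdorffMeasure (E := Rn n)
  exact ⟨_, Measure.isAddLeftInvariant_eq_smul volume μH[(n : ℝ)]⟩

theorem volume_image_le_of_lipschitzWith {n : ℕ} {K : ℝ≥0} {f : Rn n → Rn n}
    (hf : LipschitzWith K f) (S : Set (Rn n)) : volume (f '' S) ≤ (K : ℝ≥0∞) ^ n * volume S := by
  obtain ⟨c, hc⟩ := volume_eq_smul_hausdorffMeasure n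
  rw [hc, Measure.smul_apply, Measure.smul_apply, smul_eq_mul, smul_eq_mul, mul_left_comm]
  gcongr
  simpa using hf.hausdorffMeasure_image_le (Nat.cast_nonneg n) S

/-- Locally finite `(n-1)`-dimensional measure forces the `n`-dimensional measure to vanish. -/
theorem IsHeight.volume_zero_set {n : ℕ} {L : ℝ≥0} {e : Rn n} {h : Rn n → ℝ}
    (hh : IsHeight L e h) : volume {x | h x = 0} = 0 := by
  obtain ⟨C, hC0, hC⟩ := hh.exists_hausdorffMeasure_le
  obtain ⟨c, hc⟩ := volume_eq_smul_hausdorffMeasure n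
  have h1 : {x | h x = 0} = ⋃ k : ℕ, {x | h x = 0} ∩ closedBall 0 k := by
    rw [← inter_iUnion, iUnion_closedBall_nat, inter_univ]
  rw [h1, measure_iUnion_null_iff]
  intro k
  rw [hc, Measure.smul_apply]
  rcases Measure.hausdorffMeasure_zero_or_top (show (n : ℝ) - 1 < n by linarith)
    ({x | h x = 0} ∩ closedBall 0 (k : ℝ)) with h2 | h2
  · simp [h2]
  · exact absurd h2 ((hC 0 k (Nat.cast_nonneg k)).trans_lt ENNReal.ofReal_lt_top).ne

theorem exists_surfaceMeasure_closedBall_le {n : ℕ} {Ω : Set (Rn n)} (hΩ : IsOpen Ω)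
    (hΩ_bdd : Bornology.IsBounded Ω) (hΩ_lip : HasLipschitzBoundary Ω) :
    ∃ C : ℝ, 0 ≤ C ∧ ∀ (y : Rn n) (r : ℝ), 0 ≤ r →
      surfaceMeasure Ω (closedBall y r) ≤ ENNReal.ofReal (C * r ^ (n - 1)) := by
  obtain ⟨t, L, e, h, hh, hcov⟩ := exists_finite_heights hΩ hΩ_bdd hΩ_lip
  have h1 : ∀ x : Rn n, ∃ C : ℝ, 0 ≤ C ∧ (x ∈ t → ∀ (y : Rn n) (r : ℝ), 0 ≤ r →
      μH[(n : ℝ) - 1] ({z | h x z = 0} ∩ closedBall y r) ≤ ENNReal.ofReal (C * r ^ (n - 1))) := by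
    intro x
    by_cases hx : x ∈ t
    · obtain ⟨C, hC0, hC⟩ := (hh x hx).exists_hausdorffMeasure_le
      exact ⟨C, hC0, fun _ => hC⟩
    · exact ⟨0, le_rfl, fun hx' => absurd hx' hx⟩
  choose C hC0 hC using h1
  refine ⟨∑ x ∈ t, C x, Finset.sum_nonneg fun x _ => hC0 x, fun y r hr => ?_⟩
  unfold surfaceMeasure
  rw [Measure.restrict_apply measurableSet_closedBall, Finset.sum_mul, inter_comm,
    ENNReal.ofReal_sum_of_nonneg fun x _ => mul_nonneg (hC0 x) (by positivity)]
  refine (measure_mono (inter_subset_inter_left _ hcov)).trans ?_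
  rw [iUnion₂_inter]
  exact (measure_biUnion_finset_le _ _).trans
    (Finset.sum_le_sum fun x hx => hC x hx y r hr)

theorem isFiniteMeasure_surfaceMeasure {n : ℕ} {Ω : Set (Rn n)} (hΩ : IsOpen Ω)
    (hΩ_bdd : Bornology.IsBounded Ω) (hΩ_lip : HasLipschitzBoundary Ω) :
    IsFiniteMeasure (surfaceMeasure Ω) := by
  obtain ⟨C, hC0, hC⟩ := exists_surfaceMeasure_closedBall_le hΩ hΩ_bdd hΩ_lip
  obtain ⟨R, hR⟩ := (hΩ_bdd.closure.subset frontier_subset_closure).subset_closedBall (0 : Rn n)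
  refine ⟨?_⟩
  have h1 : surfaceMeasure Ω univ = surfaceMeasure Ω (closedBall 0 (max R 0)) := by
    unfold surfaceMeasure
    rw [Measure.restrict_apply_univ, Measure.restrict_apply measurableSet_closedBall,
      inter_eq_right.2 (hR.trans (closedBall_subset_closedBall (le_max_left _ _)))]
  rw [h1]
  exact (hC 0 _ (le_max_right _ _)).trans_lt ENNReal.ofReal_lt_top

/-- After Fubini a point `y` is weighted by the surface measure of a ball about it, at most `C
r^(n-1)`, and only points of the layer count. The product `ε^(-n) ε^(n-1)` leaves `ε⁻¹`. -/
theorem lintegral_sq_q1Interp_surfaceMeasure_le {n : ℕ} (hn : 0 < n) {Ω : Set (Rn n)}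
    {C : ℝ} (hC0 : 0 ≤ C) [IsFiniteMeasure (surfaceMeasure Ω)]
    (hC : ∀ (y : Rn n) (r : ℝ), 0 ≤ r →
      surfaceMeasure Ω (closedBall y r) ≤ ENNReal.ofReal (C * r ^ (n - 1)))
    {ε : ℝ} (hε : 0 < ε) {u : Rn n → ℝ} (hu : Measurable u) :
    ∫⁻ x, ENNReal.ofReal (q1Interp ε u x ^ 2) ∂(surfaceMeasure Ω) ≤
      ENNReal.ofReal (2 ^ n * C * (3 * √n) ^ (n - 1) * ε⁻¹) *
        ∫⁻ y in thickening (3 * √n * ε) (frontier Ω), ENNReal.ofReal (u y ^ 2) := by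
  set r := 3 * √n * ε with hr
  have hr0 : 0 ≤ r := by positivity
  set B : Set (Rn n × Rn n) := {p | dist p.2 p.1 < r} with hB
  have hBm : MeasurableSet B := measurableSet_lt (by fun_prop) (by fun_prop)
  set F : Rn n × Rn n → ℝ≥0∞ := B.indicator fun p => ENNReal.ofReal (u p.2 ^ 2) with hF
  have hFm : Measurable F := Measurable.indicator (by fun_prop) hBm
  have hball : ∀ x, ∫⁻ y in ball x r, ENNReal.ofReal (u y ^ 2) = ∫⁻ y, F (x, y) := by
    intro x
    rw [← lintegral_indicator measurableSet_ball]
    exact lintegral_congr fun y => by simp [hF, hB, indicator]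
  have hsec : ∀ y, ∫⁻ x, F (x, y) ∂(surfaceMeasure Ω) ≤
      (thickening r (frontier Ω)).indicator
        (fun y => ENNReal.ofReal (C * r ^ (n - 1)) * ENNReal.ofReal (u y ^ 2)) y := by
    intro y
    by_cases hy : y ∈ thickening r (frontier Ω)
    · rw [indicator_of_mem hy]
      calc ∫⁻ x, F (x, y) ∂(surfaceMeasure Ω)
          ≤ ∫⁻ x, (closedBall y r).indicator (fun _ => ENNReal.ofReal (u y ^ 2)) x
              ∂(surfaceMeasure Ω) := by
            refine lintegral_mono fun x => ?_
            by_cases hx : dist y x < r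
            · rw [indicator_of_mem (by rw [mem_closedBall, dist_comm]; exact hx.le), hF,
                indicator_of_mem (by exact hx)]
            · rw [hF, indicator_of_notMem (by exact hx)]
              exact zero_le
        _ = ENNReal.ofReal (u y ^ 2) * surfaceMeasure Ω (closedBall y r) := by
            rw [lintegral_indicator measurableSet_closedBall, setLIntegral_const]
        _ ≤ _ := by
            rw [mul_comm]
            exact mul_le_mul_left (hC y r hr0) _
    · rw [indicator_of_notMem hy, nonpos_iff_eq_zero]
      unfold surfaceMeasure
      rw [← lintegral_zero (μ := (μH[(n : ℝ) - 1]).restrict (frontier Ω))]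
      refine setLIntegral_congr_fun isClosed_frontier.measurableSet fun x hx => ?_
      rw [hF]
      refine indicator_of_notMem (fun hxy => hy ?_) _
      exact mem_thickening_iff.2 ⟨x, hx, hxy⟩
  calc ∫⁻ x, ENNReal.ofReal (q1Interp ε u x ^ 2) ∂(surfaceMeasure Ω)
      ≤ ∫⁻ x, (ENNReal.ofReal (2 ^ n * (ε ^ n)⁻¹) * ∫⁻ y, F (x, y)) ∂(surfaceMeasure Ω) := by
        refine lintegral_mono fun x => ?_
        rw [← hball]
        exact ofReal_sq_q1Interp_le hn hε hu x
    _ = ENNReal.ofReal (2 ^ n * (ε ^ n)⁻¹) * ∫⁻ y, (∫⁻ x, F (x, y) ∂(surfaceMeasure Ω)) := by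
        rw [lintegral_const_mul' _ _ ENNReal.ofReal_ne_top,
          lintegral_lintegral_swap (f := fun x y => F (x, y)) hFm.aemeasurable]
    _ ≤ ENNReal.ofReal (2 ^ n * (ε ^ n)⁻¹) * (ENNReal.ofReal (C * r ^ (n - 1)) *
          ∫⁻ y in thickening r (frontier Ω), ENNReal.ofReal (u y ^ 2)) := by
        rw [← lintegral_const_mul' _ _ ENNReal.ofReal_ne_top (μ := volume.restrict _),
          ← lintegral_indicator isOpen_thickening.measurableSet]
        exact mul_le_mul_right (lintegral_mono hsec) _
    _ = _ := by
        rw [← mul_assoc, ← ENNReal.ofReal_mul (by positivity)]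
        congr 2
        obtain ⟨m, rfl⟩ : ∃ m, n = m + 1 := ⟨n - 1, by omega⟩
        rw [hr, mul_pow _ ε]
        simp only [Nat.add_sub_cancel]
        field_simp
        ring

/-! ### The extension operator: cutoff, folding, partition of unity. -/

/-- In polar coordinates the integrand is of order at most `r^(1-2s)` near 0, integrable as `s < 1`,
and `r^(-1-2s)` at infinity, integrable as `s > 0`. -/
theorem integrable_min_div_norm_rpow {n : ℕ} (hn : 0 < n) {s : ℝ} (hs0 : 0 < s) (hs1 : s < 1)
    (Λ : ℝ) :
    Integrable fun z : Rn n => min ((Λ * ‖z‖) ^ 2) 4 / ‖z‖ ^ ((n : ℝ) + 2 * s) := by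
  have : Nonempty (Fin n) := ⟨⟨0, hn⟩⟩
  have hnt : Nontrivial (Rn n) := by
    refine Module.nontrivial_of_finrank_pos (R := ℝ) ?_
    rw [finrank_euclideanSpace_fin]; exact hn
  rw [integrable_fun_norm_addHaar volume
    (f := fun r : ℝ => min ((Λ * r) ^ 2) 4 / r ^ ((n : ℝ) + 2 * s)), finrank_euclideanSpace_fin]
  have hmeas : Measurable fun r : ℝ =>
      r ^ (n - 1) • (min ((Λ * r) ^ 2) 4 / r ^ ((n : ℝ) + 2 * s)) := by fun_prop
  have hid : ∀ r : ℝ, 0 < r → r ^ (n - 1) • (min ((Λ * r) ^ 2) 4 / r ^ ((n : ℝ) + 2 * s)) =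
      min ((Λ * r) ^ 2) 4 * r ^ (-1 - 2 * s) := by
    intro r hr
    have h1 : r ^ (n - 1) = r ^ ((n : ℝ) - 1) := by
      rw [← Real.rpow_natCast, Nat.cast_sub hn, Nat.cast_one]
    rw [smul_eq_mul, h1, mul_div_assoc', mul_comm (r ^ _), mul_div_assoc, ← Real.rpow_sub hr]
    congr 2; ring
  rw [← Ioc_union_Ioi_eq_Ioi zero_le_one]
  refine IntegrableOn.union ?_ ?_
  · have h1 : IntegrableOn (fun r : ℝ => Λ ^ 2 * r ^ (1 - 2 * s)) (Ioc 0 1) :=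
      ((intervalIntegrable_iff_integrableOn_Ioc_of_le zero_le_one).1
        (intervalIntegral.intervalIntegrable_rpow' (by linarith))).const_mul _
    refine h1.mono' hmeas.aestronglyMeasurable ?_
    refine (ae_restrict_mem measurableSet_Ioc).mono fun r hr => ?_
    rw [hid r hr.1, Real.norm_of_nonneg (mul_nonneg (by positivity) (Real.rpow_nonneg hr.1.le _))]
    calc min ((Λ * r) ^ 2) 4 * r ^ (-1 - 2 * s) ≤ (Λ * r) ^ 2 * r ^ (-1 - 2 * s) :=
          mul_le_mul_of_nonneg_right (min_le_left _ _) (Real.rpow_nonneg hr.1.le _)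
      _ = Λ ^ 2 * (r ^ (2 : ℝ) * r ^ (-1 - 2 * s)) := by rw [Real.rpow_two]; ring
      _ = _ := by rw [← Real.rpow_add hr.1]; congr 2; ring
  · have h1 : IntegrableOn (fun r : ℝ => 4 * r ^ (-1 - 2 * s)) (Ioi 1) :=
      (integrableOn_Ioi_rpow_of_lt (by linarith) one_pos).const_mul _
    refine h1.mono' hmeas.aestronglyMeasurable ?_
    refine (ae_restrict_mem measurableSet_Ioi).mono fun r hr => ?_
    have hr0 : 0 < r := one_pos.trans hr
    rw [hid r hr0, Real.norm_of_nonneg (mul_nonneg (by positivity) (Real.rpow_nonneg hr0.le _))]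
    exact mul_le_mul_of_nonneg_right (min_le_right _ _) (Real.rpow_nonneg hr0.le _)

theorem exists_lintegral_cutoff_kernel_le {n : ℕ} (hn : 0 < n) {s : ℝ} (hs0 : 0 < s) (hs1 : s < 1)
    {θ : Rn n → ℝ} {Λ : ℝ≥0} (hθ : LipschitzWith Λ θ) (hθ1 : ∀ x, |θ x| ≤ 1) :
    ∃ C : ℝ≥0, ∀ x, ∫⁻ y, ENNReal.ofReal ((θ x - θ y) ^ 2 / ‖x - y‖ ^ ((n : ℝ) + 2 * s)) ≤ C := by
  have hI := integrable_min_div_norm_rpow hn hs0 hs1 (Λ : ℝ)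
  have hfin := hI.lintegral_lt_top
  refine ⟨(∫⁻ z : Rn n, ENNReal.ofReal
    (min ((Λ * ‖z‖) ^ 2) 4 / ‖z‖ ^ ((n : ℝ) + 2 * s))).toNNReal, fun x => ?_⟩
  rw [ENNReal.coe_toNNReal hfin.ne, ← lintegral_sub_left_eq_self (fun z : Rn n => ENNReal.ofReal
    (min ((Λ * ‖z‖) ^ 2) 4 / ‖z‖ ^ ((n : ℝ) + 2 * s))) x]
  refine lintegral_mono fun y => ENNReal.ofReal_le_ofReal ?_
  gcongr
  refine le_min ?_ ?_
  · have h1 := hθ.dist_le_mul x y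
    rw [Real.dist_eq, dist_eq_norm] at h1
    rw [← sq_abs]
    gcongr
  · have h1 : |θ x - θ y| ≤ 2 := (abs_sub _ _).trans (by linarith [hθ1 x, hθ1 y])
    rw [← sq_abs]
    nlinarith [abs_nonneg (θ x - θ y)]

theorem sq_mul_sub_mul_le {n : ℕ} {θ f : Rn n → ℝ} {V : Set (Rn n)} (hθ1 : ∀ x, |θ x| ≤ 1)
    (hθV : ∀ x, x ∉ V → θ x = 0) (x y : Rn n) :
    (θ x * f x - θ y * f y) ^ 2 ≤
      2 * (V.indicator (fun x => V.indicator (fun y => (f x - f y) ^ 2) y) x) +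
      2 * (V.indicator (fun x => f x ^ 2) x * (θ x - θ y) ^ 2) +
      2 * (V.indicator (fun x => f x ^ 2) y * (θ x - θ y) ^ 2) := by
  by_cases hx : x ∈ V <;> by_cases hy : y ∈ V
  · simp only [indicator_of_mem hx, indicator_of_mem hy]
    have h1 : θ x * f x - θ y * f y = θ x * (f x - f y) + f y * (θ x - θ y) := by ring
    have h2 : θ x ^ 2 ≤ 1 := by
      rw [← sq_abs]; exact pow_le_one₀ (abs_nonneg _) (hθ1 x)
    rw [h1]
    have h3 : (θ x * (f x - f y)) ^ 2 ≤ (f x - f y) ^ 2 := by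
      rw [mul_pow]; exact mul_le_of_le_one_left (sq_nonneg _) h2
    have h4 : 0 ≤ f x ^ 2 * (θ x - θ y) ^ 2 := by positivity
    nlinarith [sq_nonneg (θ x * (f x - f y) - f y * (θ x - θ y))]
  · simp only [indicator_of_mem hx, indicator_of_notMem hy, hθV y hy]
    nlinarith [sq_nonneg (θ x * f x)]
  · simp only [indicator_of_mem hy, indicator_of_notMem hx, hθV x hx]
    nlinarith [sq_nonneg (θ y * f y)]
  · simp [hθV x hx, hθV y hy, hx]

/-- A difference of products splits into a difference of `f`, taken inside `V` only, and differences
of `θ` weighted by `f²` on `V`; the latter integrate against the uniformly bounded kernel. No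
control of `f` outside `V` is needed. -/
theorem exists_hsEnergy_cutoff_le {n : ℕ} (hn : 0 < n) {s : ℝ} (hs0 : 0 < s) (hs1 : s < 1)
    {θ : Rn n → ℝ} {Λ : ℝ≥0} (hθ : LipschitzWith Λ θ) (hθ1 : ∀ x, |θ x| ≤ 1) {V : Set (Rn n)}
    (hV : MeasurableSet V) (hθV : ∀ x, x ∉ V → θ x = 0) :
    ∃ C : ℝ≥0, ∀ f : Rn n → ℝ, Measurable f →
      hsEnergy s univ (fun x => θ x * f x) ≤ C * hsEnergy s V f := by
  obtain ⟨C, hC⟩ := exists_lintegral_cutoff_kernel_le hn hs0 hs1 hθ hθ1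
  refine ⟨2 + 4 * C, fun f hf => ?_⟩
  have hθm : Measurable θ := hθ.continuous.measurable
  set A := ∫⁻ x in V, ENNReal.ofReal (f x ^ 2) with hA
  set D : Rn n → Rn n → ℝ := fun x y => ‖x - y‖ ^ ((n : ℝ) + 2 * s) with hD
  have hD0 : ∀ x y, 0 ≤ D x y := fun x y => Real.rpow_nonneg (norm_nonneg _) _
  set k : Rn n → Rn n → ℝ≥0∞ := fun x y => ENNReal.ofReal ((θ x - θ y) ^ 2 / D x y) with hk
  set F : Rn n → ℝ≥0∞ := V.indicator fun x => ENNReal.ofReal (f x ^ 2) with hF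
  have hFm : Measurable F := Measurable.indicator (by fun_prop) hV
  have hkm : Measurable (Function.uncurry k) := by
    simp only [hk, hD, Function.uncurry_def]
    fun_prop
  have hFof : ∀ x, ENNReal.ofReal (V.indicator (fun x => f x ^ 2) x) = F x := by
    intro x; by_cases hx : x ∈ V <;> simp [hF, hx]
  have hA' : ∫⁻ x, F x = A := lintegral_indicator hV _
  have hL2 : ∫⁻ x, ENNReal.ofReal ((θ x * f x) ^ 2) ≤ A := by
    rw [← hA']
    refine lintegral_mono fun x => ?_
    rw [← hFof]
    refine ENNReal.ofReal_le_ofReal ?_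
    by_cases hx : x ∈ V
    · rw [indicator_of_mem hx, mul_pow]
      refine mul_le_of_le_one_left (sq_nonneg _) ?_
      rw [← sq_abs]; exact pow_le_one₀ (abs_nonneg _) (hθ1 x)
    · simp [hθV x hx, hx]
  set g : Rn n → Rn n → ℝ≥0∞ := fun x y =>
    V.indicator (fun x => V.indicator (fun y => ENNReal.ofReal ((f x - f y) ^ 2 / D x y)) y) x with hg
  have hptw : ∀ x y, ENNReal.ofReal ((θ x * f x - θ y * f y) ^ 2 / D x y) ≤
      2 * g x y + 2 * (F x * k x y) + 2 * (F y * k x y) := by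
    intro x y
    have h2 : (2 : ℝ≥0∞) = ENNReal.ofReal 2 := by simp
    have hi : ∀ z, 0 ≤ V.indicator (fun x => f x ^ 2) z := fun z =>
      indicator_nonneg (fun _ _ => sq_nonneg _) z
    have hg' : g x y = ENNReal.ofReal
        (V.indicator (fun x => V.indicator (fun y => (f x - f y) ^ 2) y) x / D x y) := by
      simp only [hg]
      by_cases hx : x ∈ V <;> by_cases hy : y ∈ V <;> simp [hx, hy]
    have hi2 : 0 ≤ V.indicator (fun x => V.indicator (fun y => (f x - f y) ^ 2) y) x :=
      indicator_nonneg (fun _ _ => indicator_nonneg (fun _ _ => sq_nonneg _) _) _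
    have hq : 0 ≤ (θ x - θ y) ^ 2 / D x y := div_nonneg (sq_nonneg _) (hD0 x y)
    have hq2 := div_nonneg hi2 (hD0 x y)
    rw [hg', ← hFof x, ← hFof y, hk, h2]
    simp only
    rw [← ENNReal.ofReal_mul (hi x), ← ENNReal.ofReal_mul (hi y),
      ← ENNReal.ofReal_mul zero_le_two, ← ENNReal.ofReal_mul zero_le_two,
      ← ENNReal.ofReal_mul zero_le_two,
      ← ENNReal.ofReal_add (mul_nonneg zero_le_two hq2)
        (mul_nonneg zero_le_two (mul_nonneg (hi x) hq)),
      ← ENNReal.ofReal_add (add_nonneg (mul_nonneg zero_le_two hq2)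
        (mul_nonneg zero_le_two (mul_nonneg (hi x) hq)))
        (mul_nonneg zero_le_two (mul_nonneg (hi y) hq))]
    refine ENNReal.ofReal_le_ofReal ?_
    refine (div_le_div_of_nonneg_right (sq_mul_sub_mul_le hθ1 hθV x y) (hD0 x y)).trans
      (le_of_eq ?_)
    ring
  have hgm : Measurable (Function.uncurry g) := by
    have : Function.uncurry g = (V ×ˢ V).indicator fun p : Rn n × Rn n =>
        ENNReal.ofReal ((f p.1 - f p.2) ^ 2 / D p.1 p.2) := by
      ext ⟨x, y⟩
      by_cases hx : x ∈ V <;> by_cases hy : y ∈ V <;> simp [hg, hx, hy]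
    rw [this]
    refine Measurable.indicator ?_ (hV.prod hV)
    simp only [hD]
    fun_prop
  have hgI : ∫⁻ x, ∫⁻ y, g x y = gagliardo s V f := by
    unfold gagliardo
    rw [← lintegral_indicator hV]
    refine lintegral_congr fun x => ?_
    by_cases hx : x ∈ V
    · simp only [hg, indicator_of_mem hx]
      rw [lintegral_indicator hV]
    · simp [hg, hx]
  have hFk1 : ∫⁻ x, ∫⁻ y, F x * k x y ≤ C * A := by
    rw [← hA', ← lintegral_const_mul' _ _ ENNReal.coe_ne_top]
    refine lintegral_mono fun x => ?_
    rw [lintegral_const_mul _ (hkm.of_uncurry_left), mul_comm]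
    exact mul_le_mul_left (hC x) _
  have hFkm : Measurable (Function.uncurry fun x y => F x * k x y) :=
    (hFm.comp measurable_fst).mul hkm
  have hFkm' : Measurable (Function.uncurry fun x y => F y * k x y) :=
    (hFm.comp measurable_snd).mul hkm
  have hFk2 : ∫⁻ x, ∫⁻ y, F y * k x y ≤ C * A := by
    rw [lintegral_lintegral_swap hFkm'.aemeasurable]
    refine le_trans (le_of_eq ?_) hFk1
    refine lintegral_congr fun x => lintegral_congr fun y => ?_
    simp only [hk, hD]
    rw [norm_sub_rev, ← neg_sub (θ x), neg_sq]
  have hgag : gagliardo s univ (fun x => θ x * f x) ≤ 2 * gagliardo s V f + 4 * C * A := by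
    calc gagliardo s univ (fun x => θ x * f x)
        ≤ ∫⁻ x, ∫⁻ y, (2 * g x y + 2 * (F x * k x y) + 2 * (F y * k x y)) := by
          unfold gagliardo
          simp only [Measure.restrict_univ]
          exact lintegral_mono fun x => lintegral_mono fun y => hptw x y
      _ = ∫⁻ x, (2 * (∫⁻ y, g x y) + 2 * (∫⁻ y, F x * k x y) + 2 * ∫⁻ y, F y * k x y) := by
          refine lintegral_congr fun x => ?_
          have m1 : Measurable fun y => g x y := hgm.of_uncurry_left
          have m2 : Measurable fun y => F x * k x y := hFkm.of_uncurry_left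
          rw [lintegral_add_left (by fun_prop),
            lintegral_add_left (m1.const_mul 2), lintegral_const_mul' 2 _ (by simp),
            lintegral_const_mul' 2 _ (by simp), lintegral_const_mul' 2 _ (by simp)]
      _ = 2 * (∫⁻ x, ∫⁻ y, g x y) + 2 * (∫⁻ x, ∫⁻ y, F x * k x y) +
            2 * ∫⁻ x, ∫⁻ y, F y * k x y := by
          have m1 : Measurable fun x => ∫⁻ y, g x y := hgm.lintegral_prod_right
          have m2 : Measurable fun x => ∫⁻ y, F x * k x y := hFkm.lintegral_prod_right
          rw [lintegral_add_left (by fun_prop),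
            lintegral_add_left (m1.const_mul 2), lintegral_const_mul' 2 _ (by simp),
            lintegral_const_mul' 2 _ (by simp), lintegral_const_mul' 2 _ (by simp)]
      _ ≤ 2 * gagliardo s V f + 2 * (C * A) + 2 * (C * A) := by
          rw [hgI]
          gcongr
      _ = _ := by ring
  unfold hsEnergy
  rw [Measure.restrict_univ, ← hA]
  calc (∫⁻ x, ENNReal.ofReal ((θ x * f x) ^ 2)) + gagliardo s univ (fun x => θ x * f x)
      ≤ A + (2 * gagliardo s V f + 4 * C * A) := add_le_add hL2 hgag
    _ ≤ (A + A + 4 * C * gagliardo s V f) + (2 * gagliardo s V f + 4 * C * A) := by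
        gcongr
        exact le_self_add.trans le_self_add
    _ = _ := by push_cast; ring

theorem lintegral_comp_le_of_measure_preimage_le {n : ℕ} {Ω V : Set (Rn n)}
    {T : Rn n → Rn n} (hT : Measurable T) {M : ℝ≥0}
    (hM : ∀ A, MeasurableSet A → volume (V ∩ T ⁻¹' A) ≤ M * volume (A ∩ Ω)) {F : Rn n → ℝ≥0∞}
    (hF : Measurable F) : ∫⁻ x in V, F (T x) ≤ M * ∫⁻ x in Ω, F x := by
  rw [← lintegral_map hF hT, ← smul_eq_mul, ← lintegral_smul_measure]
  refine lintegral_mono' (Measure.le_iff.2 fun A hA => ?_) le_rfl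
  rw [Measure.map_apply hT hA, Measure.restrict_apply (hT hA), Measure.smul_apply,
    Measure.restrict_apply hA, inter_comm]
  exact hM A hA

/-- The Lipschitz bound compares the two kernels at the cost of `K^(n+2s)`, and each change of
variable costs `M`. Injectivity of `T` is not needed, only the pushforward bound `hM`. -/
theorem exists_hsEnergy_comp_le {n : ℕ} {s : ℝ} (hs0 : 0 < s) {Ω V : Set (Rn n)}
    {T : Rn n → Rn n} {K : ℝ≥0} (hT : LipschitzWith K T) {M : ℝ≥0}
    (hM : ∀ A, MeasurableSet A → volume (V ∩ T ⁻¹' A) ≤ M * volume (A ∩ Ω)) :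
    ∃ C : ℝ≥0, ∀ f : Rn n → ℝ, Measurable f → hsEnergy s V (f ∘ T) ≤ C * hsEnergy s Ω f := by
  set p : ℝ := (n : ℝ) + 2 * s with hp
  have hp0 : 0 < p := by positivity
  refine ⟨M + (K ^ p * M * M), fun f hf => ?_⟩
  have hTm : Measurable T := hT.continuous.measurable
  set g : Rn n → Rn n → ℝ≥0∞ := fun x y => ENNReal.ofReal ((f x - f y) ^ 2 / ‖x - y‖ ^ p) with hg
  have hgm : Measurable (Function.uncurry g) := by
    simp only [hg, Function.uncurry_def]
    fun_prop
  have h1 : ∫⁻ x in V, ENNReal.ofReal ((f ∘ T) x ^ 2) ≤ M * ∫⁻ x in Ω, ENNReal.ofReal (f x ^ 2) :=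
    lintegral_comp_le_of_measure_preimage_le hTm hM
      (F := fun x => ENNReal.ofReal (f x ^ 2)) (by fun_prop)
  have hptw : ∀ x y, ENNReal.ofReal (((f ∘ T) x - (f ∘ T) y) ^ 2 / ‖x - y‖ ^ p) ≤
      (K ^ p : ℝ≥0) * g (T x) (T y) := by
    intro x y
    simp only [hg, Function.comp]
    rw [← ENNReal.ofReal_coe_nnreal, ← ENNReal.ofReal_mul NNReal.zero_le_coe]
    refine ENNReal.ofReal_le_ofReal ?_
    by_cases hxy : T x = T y
    · simp [hxy]
    have h2 : 0 < ‖T x - T y‖ := norm_pos_iff.2 (sub_ne_zero.2 hxy)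
    have h3 : ‖T x - T y‖ ≤ K * ‖x - y‖ := by
      simpa [dist_eq_norm] using hT.dist_le_mul x y
    have h4 : 0 < ‖x - y‖ := by
      rcases (norm_nonneg (x - y)).lt_or_eq with h | h
      · exact h
      · rw [← h, mul_zero] at h3; linarith
    have h5 : ‖T x - T y‖ ^ p ≤ K ^ p * ‖x - y‖ ^ p := by
      rw [← Real.mul_rpow (by positivity) h4.le]
      exact Real.rpow_le_rpow h2.le h3 hp0.le
    rw [NNReal.coe_rpow, mul_div_assoc', div_le_div_iff₀ (Real.rpow_pos_of_pos h4 _)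
      (Real.rpow_pos_of_pos h2 _)]
    calc (f (T x) - f (T y)) ^ 2 * ‖T x - T y‖ ^ p
        ≤ (f (T x) - f (T y)) ^ 2 * (K ^ p * ‖x - y‖ ^ p) := by gcongr
      _ = _ := by ring
  have h2 : gagliardo s V (f ∘ T) ≤ (K ^ p : ℝ≥0) * (M * (M * gagliardo s Ω f)) := by
    unfold gagliardo
    rw [← hp]
    calc ∫⁻ x in V, ∫⁻ y in V, ENNReal.ofReal (((f ∘ T) x - (f ∘ T) y) ^ 2 / ‖x - y‖ ^ p)
        ≤ ∫⁻ x in V, ∫⁻ y in V, (K ^ p : ℝ≥0) * g (T x) (T y) :=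
          lintegral_mono fun x => lintegral_mono fun y => hptw x y
      _ = (K ^ p : ℝ≥0) * ∫⁻ x in V, ∫⁻ y in V, g (T x) (T y) := by
          simp_rw [lintegral_const_mul' _ _ (ENNReal.coe_ne_top (r := K ^ p))]
      _ ≤ (K ^ p : ℝ≥0) * ∫⁻ x in V, M * ∫⁻ y in Ω, g (T x) y := by
          refine mul_le_mul_right (lintegral_mono fun x => ?_) _
          exact lintegral_comp_le_of_measure_preimage_le hTm hM (F := fun y => g (T x) y)
            hgm.of_uncurry_left
      _ ≤ _ := by
          rw [lintegral_const_mul' _ _ ENNReal.coe_ne_top]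
          refine mul_le_mul_right (mul_le_mul_right ?_ _) _
          exact lintegral_comp_le_of_measure_preimage_le hTm hM
            (F := fun x => ∫⁻ y in Ω, g x y) hgm.lintegral_prod_right
  unfold hsEnergy
  refine (add_le_add h1 h2).trans ?_
  rw [← mul_assoc, ← mul_assoc, mul_add]
  push_cast
  gcongr
  · exact le_self_add
  · exact le_add_self

/-- `T` folds the bounded open set `V` into `Ω`, fixing `V ∩ Ω`, so that `φ ∘ T` extends `φ`
from `V ∩ Ω` to `V`. -/
structure IsFolding {n : ℕ} (Ω V : Set (Rn n)) (T : Rn n → Rn n) (K M : ℝ≥0) : Prop where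
  isOpen : IsOpen V
  isBounded : Bornology.IsBounded V
  lipschitz : LipschitzWith K T
  volume_le : ∀ A, MeasurableSet A → volume (V ∩ T ⁻¹' A) ≤ M * volume (A ∩ Ω)
  fixed : ∀ y ∈ V, y ∈ Ω → T y = y

theorem isFolding_id {n : ℕ} {Ω : Set (Rn n)} (hΩ : IsOpen Ω) (hb : Bornology.IsBounded Ω) :
    IsFolding Ω Ω id 1 1 where
  isOpen := hΩ
  isBounded := hb
  lipschitz := LipschitzWith.id
  volume_le A _ := by simp [inter_comm]
  fixed _ _ _ := rfl

theorem IsHeight.lipschitzWith_add_smul {n : ℕ} {L : ℝ≥0} {e : Rn n} {h : Rn n → ℝ}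
    (hh : IsHeight L e h) {g : ℝ → ℝ} (hg : LipschitzWith 2 g) :
    LipschitzWith (1 + 2 * L) fun y => y + g (h y) • e := by
  have h1 : LipschitzWith 1 fun t : ℝ => t • e := by
    refine LipschitzWith.of_dist_le_mul fun t t' => ?_
    rw [dist_eq_norm, ← sub_smul, norm_smul, hh.norm_eq, dist_eq_norm]
    simp
  have h2 := LipschitzWith.id.add (h1.comp (hg.comp hh.lipschitz))
  rwa [one_mul] at h2

/-- `T` replaces the height `h` by `|h|`: it is the identity above the graph and the Lipschitz
involution `R` below, and the graph is null. The two sides contribute `1` and `(1 + 2L)^n` to the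
volume factor. Since `T x = x`, the radius `r / (1 + 2L)` keeps the image inside the chart. -/
theorem IsBoundaryChart.isFolding {n : ℕ} {Ω : Set (Rn n)} (hΩ : IsOpen Ω) {x : Rn n} {L : ℝ≥0}
    {e : Rn n} {h : Rn n → ℝ} {r : ℝ} (hc : IsBoundaryChart Ω x L e h r) (hx : x ∈ frontier Ω) :
    IsFolding Ω (ball x (r / (1 + 2 * L))) (fun y => y + (|h y| - h y) • e) (1 + 2 * L)
      (1 + (1 + 2 * L) ^ n) := by
  have hh := hc.height
  have hr := hc.pos
  have hx0 : h x = 0 := hc.eq_zero_of_mem_frontier hΩ hx (mem_ball_self hr)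
  have hL : (0 : ℝ) < 1 + 2 * L := by positivity
  have hgT : LipschitzWith 2 fun t : ℝ => |t| - t := by
    refine LipschitzWith.of_dist_le_mul fun t t' => ?_
    rw [Real.dist_eq, Real.dist_eq]
    have h1 := abs_abs_sub_abs_le t t'
    have h2 : |t| - t - (|t'| - t') = (|t| - |t'|) - (t - t') := by ring
    rw [h2]
    push_cast
    linarith [abs_sub (|t| - |t'|) (t - t')]
  have hgR : LipschitzWith 2 fun t : ℝ => -2 * t := by
    refine LipschitzWith.of_dist_le_mul fun t t' => ?_
    rw [Real.dist_eq, Real.dist_eq, ← mul_sub, abs_mul]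
    norm_num
  have hT := hh.lipschitzWith_add_smul hgT
  have hR := hh.lipschitzWith_add_smul hgR
  set T : Rn n → Rn n := fun y => y + (|h y| - h y) • e with hTdef
  set R : Rn n → Rn n := fun y => y + (-2 * h y) • e with hRdef
  have hTball : ∀ y ∈ ball x (r / (1 + 2 * L)), T y ∈ ball x r := by
    intro y hy
    have h1 := hT.dist_le_mul y x
    have hTx : T x = x := by simp [hTdef, hx0]
    rw [hTx] at h1
    push_cast at h1
    rw [mem_ball] at hy ⊢
    rw [lt_div_iff₀ hL] at hy
    linarith
  have hball : ball x (r / (1 + 2 * L)) ⊆ ball x r := by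
    refine ball_subset_ball (div_le_self hr.le ?_)
    have : (0 : ℝ) ≤ L := L.2
    linarith
  have hRR : ∀ y, R (R y) = y := by
    intro y
    simp only [hRdef, hh.add_smul]
    rw [add_assoc, ← add_smul]
    have : -2 * h y + -2 * (h y + -2 * h y) = 0 := by ring
    rw [this, zero_smul, add_zero]
  refine ⟨isOpen_ball, isBounded_ball, hT, fun A _ => ?_, fun y hy hyΩ => ?_⟩
  · have hsub : ball x (r / (1 + 2 * L)) ∩ T ⁻¹' A ⊆
        ((A ∩ Ω) ∪ R '' (A ∩ Ω)) ∪ {y | h y = 0} := by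
      rintro y ⟨hyV, hyA⟩
      have hTy := hTball y hyV
      rcases lt_trichotomy (h y) 0 with hy | hy | hy
      · have hTR : T y = R y := by
          simp only [hTdef, hRdef, abs_of_neg hy]
          congr 2; ring
        rw [hTR] at hTy
        have h1 : h (R y) = - h y := by
          simp only [hRdef, hh.add_smul]; ring
        refine Or.inl (Or.inr ⟨R y, ⟨by rw [← hTR]; exact hyA, ?_⟩, hRR y⟩)
        rw [hc.mem_iff _ hTy, h1]
        linarith
      · exact Or.inr hy
      · have hTy' : T y = y := by simp [hTdef, abs_of_pos hy]
        rw [mem_preimage, hTy'] at hyA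
        exact Or.inl (Or.inl ⟨hyA, (hc.mem_iff y (hball hyV)).2 hy⟩)
    refine (measure_mono hsub).trans ((measure_union_le _ _).trans ?_)
    rw [hh.volume_zero_set, add_zero]
    refine (measure_union_le _ _).trans ?_
    rw [ENNReal.coe_add, add_mul, ENNReal.coe_one, one_mul, ENNReal.coe_pow]
    gcongr
    exact volume_image_le_of_lipschitzWith hR _
  · have := (hc.mem_iff y (hball hy)).1 hyΩ
    simp [hTdef, abs_of_pos this]

theorem exists_finite_foldings {n : ℕ} {Ω : Set (Rn n)} (hΩ : IsOpen Ω)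
    (hΩ_bdd : Bornology.IsBounded Ω) (hΩ_lip : HasLipschitzBoundary Ω) :
    ∃ (t : Finset (Rn n)) (V : Option t → Set (Rn n)) (T : Option t → Rn n → Rn n)
      (K M : Option t → ℝ≥0),
      (∀ i, IsFolding Ω (V i) (T i) (K i) (M i)) ∧ closure Ω ⊆ ⋃ i, V i := by
  obtain ⟨t, L, e, h, r, hc, hcov⟩ := exists_finite_charts hΩ_bdd hΩ_lip
    (fun _ L r => r / (1 + 2 * L)) (fun _ L r hr => by positivity)
  -- The index `none` stands for the interior piece, `Ω` itself with the identity.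
  refine ⟨t, fun i => i.elim Ω fun x => ball x (r x / (1 + 2 * L x)),
    fun i => i.elim id fun x => fun y => y + (|h x y| - h x y) • e x,
    fun i => i.elim 1 fun x => 1 + 2 * L x, fun i => i.elim 1 fun x => 1 + (1 + 2 * L x) ^ n,
    ?_, ?_⟩
  · rintro (_ | x)
    · exact isFolding_id hΩ hΩ_bdd
    · exact (hc x x.2).2.isFolding hΩ (hc x x.2).1
  · intro y hy
    by_cases hyΩ : y ∈ Ω
    · exact mem_iUnion.2 ⟨none, hyΩ⟩
    · have : y ∈ frontier Ω := by rw [hΩ.frontier_eq]; exact ⟨hy, hyΩ⟩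
      obtain ⟨x, hx, hyx⟩ := mem_iUnion₂.1 (hcov this)
      exact mem_iUnion.2 ⟨some ⟨x, hx⟩, hyx⟩

open scoped Manifold in
theorem exists_lipschitz_partition {n : ℕ} {ι : Type} [Fintype ι] {S : Set (Rn n)}
    (hS : IsClosed S) {V : ι → Set (Rn n)} (hVo : ∀ i, IsOpen (V i))
    (hVb : ∀ i, Bornology.IsBounded (V i)) (hcov : S ⊆ ⋃ i, V i) :
    ∃ (θ : ι → Rn n → ℝ) (Λ : ι → ℝ≥0), (∀ i, LipschitzWith (Λ i) (θ i)) ∧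
      (∀ i x, |θ i x| ≤ 1) ∧ (∀ i x, x ∉ V i → θ i x = 0) ∧ ∀ x ∈ S, ∑ i, θ i x = 1 := by
  obtain ⟨f, hf⟩ := SmoothPartitionOfUnity.exists_isSubordinate 𝓘(ℝ, Rn n) hS V hVo hcov
  have hlip : ∀ i, ∃ Λ : ℝ≥0, LipschitzWith Λ (f i) := by
    intro i
    have hcs : HasCompactSupport (f i) :=
      isCompact_of_isClosed_isBounded (isClosed_tsupport _) ((hVb i).subset (hf i))
    exact ContDiff.lipschitzWith_of_hasCompactSupport hcs (f i).contMDiff.contDiff (by simp)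
  choose Λ hΛ using hlip
  refine ⟨fun i => f i, Λ, hΛ, fun i x => ?_, fun i x hx => ?_, fun x hx => ?_⟩
  · rw [abs_of_nonneg (f.nonneg i x)]
    exact f.le_one i x
  · exact image_eq_zero_of_notMem_tsupport fun h => hx (hf i h)
  · rw [← f.sum_eq_one hx, finsum_eq_sum_of_fintype]

theorem hsEnergy_sum_le {n : ℕ} {s : ℝ} {ι : Type} [Fintype ι] {g : ι → Rn n → ℝ}
    (hg : ∀ i, Measurable (g i)) (Ω : Set (Rn n)) :
    hsEnergy s Ω (fun x => ∑ i, g i x) ≤ Fintype.card ι * ∑ i, hsEnergy s Ω (g i) := by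
  have hsq : ∀ (a : ι → ℝ) (d : ℝ), 0 ≤ d → ENNReal.ofReal ((∑ i, a i) ^ 2 / d) ≤
      Fintype.card ι * ∑ i, ENNReal.ofReal (a i ^ 2 / d) := by
    intro a d hd
    rw [← ENNReal.ofReal_sum_of_nonneg fun i _ => div_nonneg (sq_nonneg _) hd,
      ← ENNReal.ofReal_natCast, ← ENNReal.ofReal_mul (by positivity)]
    refine ENNReal.ofReal_le_ofReal ?_
    rw [← Finset.sum_div, mul_div_assoc']
    gcongr
    exact sq_sum_le_card_mul_sum_sq
  have hc : (Fintype.card ι : ℝ≥0∞) ≠ ⊤ := ENNReal.natCast_ne_top _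
  unfold hsEnergy
  rw [Finset.sum_add_distrib, mul_add]
  refine add_le_add ?_ ?_
  · rw [← lintegral_finsetSum _ fun i _ => by fun_prop, ← lintegral_const_mul' _ _ hc]
    refine lintegral_mono fun x => ?_
    simpa using hsq (fun i => g i x) 1 zero_le_one
  · unfold gagliardo
    have hm : ∀ i, Measurable (Function.uncurry fun x y =>
        ENNReal.ofReal ((g i x - g i y) ^ 2 / ‖x - y‖ ^ ((n : ℝ) + 2 * s))) := by
      intro i
      simp only [Function.uncurry_def]
      fun_prop
    rw [← lintegral_finsetSum _ fun i _ => (hm i).lintegral_prod_right,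
      ← lintegral_const_mul' _ _ hc]
    refine lintegral_mono fun x => ?_
    rw [← lintegral_finsetSum _ fun i _ => (hm i).of_uncurry_left, ← lintegral_const_mul' _ _ hc]
    refine lintegral_mono fun y => ?_
    rw [← Finset.sum_sub_distrib]
    exact hsq (fun i => g i x - g i y) _ (Real.rpow_nonneg (norm_nonneg _) _)

/-- Preimages of null sets are null in `V`, so composition with `T` is well defined on classes. -/
theorem IsFolding.comp_ae_eq {n : ℕ} {Ω V : Set (Rn n)} {T : Rn n → Rn n} {K M : ℝ≥0}
    (hT : IsFolding Ω V T K M) {φ ψ : Rn n → ℝ} (h : φ =ᵐ[volume.restrict Ω] ψ) :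
    φ ∘ T =ᵐ[volume.restrict V] ψ ∘ T := by
  have hTm : Measurable T := hT.lipschitz.continuous.measurable
  have hac : (volume.restrict V).map T ≪ volume.restrict Ω := by
    refine Measure.AbsolutelyContinuous.mk fun A hA hA0 => ?_
    rw [Measure.restrict_apply hA] at hA0
    rw [Measure.map_apply hTm hA, Measure.restrict_apply (hTm hA), inter_comm]
    have := hT.volume_le A hA
    rwa [hA0, mul_zero, nonpos_iff_eq_zero] at this
  exact ae_of_ae_map hTm.aemeasurable (hac.ae_le h)

theorem exists_isHsExtension {n : ℕ} (hn : 0 < n) {Ω : Set (Rn n)} (hΩ : IsOpen Ω)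
    (hΩ_bdd : Bornology.IsBounded Ω) (hΩ_lip : HasLipschitzBoundary Ω) {s : ℝ} (hs0 : 0 < s)
    (hs1 : s < 1) : ∃ (K : ℝ≥0) (P : (Rn n → ℝ) → (Rn n → ℝ)), IsHsExtension s Ω K P := by
  obtain ⟨t, V, T, K, M, hT, hcov⟩ := exists_finite_foldings hΩ hΩ_bdd hΩ_lip
  obtain ⟨θ, Λ, hθ, hθ1, hθV, hθsum⟩ := exists_lipschitz_partition isClosed_closure
    (fun i => (hT i).isOpen) (fun i => (hT i).isBounded) hcov
  choose C hC using fun i => exists_hsEnergy_cutoff_le hn hs0 hs1 (hθ i) (hθ1 i)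
    (hT i).isOpen.measurableSet (hθV i)
  choose D hD using fun i => exists_hsEnergy_comp_le hs0 (hT i).lipschitz (hT i).volume_le
  set P : (Rn n → ℝ) → (Rn n → ℝ) := fun φ x => ∑ i, θ i x * (φ ∘ T i) x with hP
  set B : ℝ≥0 := Fintype.card (Option t) * ∑ i, C i * D i with hB
  have hcongr : ∀ φ ψ : Rn n → ℝ, φ =ᵐ[volume.restrict Ω] ψ → P φ =ᵐ[volume] P ψ := by
    intro φ ψ h
    have h1 : ∀ᵐ x : Rn n, ∀ i, x ∈ V i → (φ ∘ T i) x = (ψ ∘ T i) x := by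
      rw [ae_all_iff]
      intro i
      exact (ae_restrict_iff' (hT i).isOpen.measurableSet).1 ((hT i).comp_ae_eq h)
    filter_upwards [h1] with x hx
    simp only [hP]
    refine Finset.sum_congr rfl fun i _ => ?_
    by_cases hxi : x ∈ V i
    · rw [hx i hxi]
    · rw [hθV i x hxi, zero_mul, zero_mul]
  have hTm : ∀ i, Measurable (T i) := fun i => (hT i).lipschitz.continuous.measurable
  have hθm : ∀ i, Measurable (θ i) := fun i => (hθ i).continuous.measurable
  have hPm : ∀ φ : Rn n → ℝ, Measurable φ → Measurable (P φ) := by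
    intro φ hφ
    exact Finset.measurable_fun_sum _ fun i _ => (hθm i).mul (hφ.comp (hTm i))
  have hmeas : ∀ φ : Rn n → ℝ, Measurable φ → hsEnergy s univ (P φ) ≤ B * hsEnergy s Ω φ := by
    intro φ hφ
    refine (hsEnergy_sum_le (fun i => (hθm i).mul (hφ.comp (hTm i))) univ).trans ?_
    rw [hB]
    push_cast
    rw [mul_assoc, Finset.sum_mul]
    gcongr with i
    refine (hC i _ (hφ.comp (hTm i))).trans ?_
    rw [mul_assoc]
    gcongr
    exact hD i φ hφ
  have hbound : ∀ φ : Rn n → ℝ, AEStronglyMeasurable φ (volume.restrict Ω) →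
      AEStronglyMeasurable (P φ) (volume.restrict univ) ∧
        hsEnergy s univ (P φ) ≤ B * hsEnergy s Ω φ := by
    intro φ hφ
    have hm := hφ.stronglyMeasurable_mk.measurable
    have h1 := hcongr φ _ hφ.ae_eq_mk
    rw [hsEnergy_congr_ae hφ.ae_eq_mk, hsEnergy_congr_ae (ae_restrict_of_ae h1)]
    refine ⟨?_, hmeas _ hm⟩
    exact (hPm _ hm).aestronglyMeasurable.congr (ae_restrict_of_ae h1.symm)
  have hnorm : ∀ φ, MemHs s Ω φ → hsNorm s univ (P φ) ≤ (NNReal.sqrt B : ℝ≥0∞) * hsNorm s Ω φ := by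
    intro φ hφ
    rw [hsNorm_eq_hsEnergy_rpow, hsNorm_eq_hsEnergy_rpow]
    refine (ENNReal.rpow_le_rpow (hbound φ hφ.1).2 (by norm_num)).trans (le_of_eq ?_)
    rw [ENNReal.mul_rpow_of_nonneg _ _ (by norm_num), NNReal.sqrt_eq_rpow,
      ENNReal.coe_rpow_of_nonneg _ (by norm_num)]
  refine ⟨NNReal.sqrt B, P, fun φ hφ => ⟨(hbound φ hφ.1).1, ?_⟩, fun φ hφ => ?_,
    fun a b φ ψ _ _ => ?_, hnorm⟩
  · exact (hnorm φ hφ).trans_lt (ENNReal.mul_lt_top ENNReal.coe_lt_top hφ.2)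
  · refine (ae_restrict_mem hΩ.measurableSet).mono fun x hx => ?_
    simp only [hP]
    -- At a point of `Ω`, either `Tᵢ` fixes it or `θᵢ` vanishes there, so the sum collapses to `φ`.
    have h1 : ∀ i ∈ (Finset.univ : Finset (Option t)), θ i x * (φ ∘ T i) x = θ i x * φ x := by
      intro i _
      by_cases hxi : x ∈ V i
      · rw [Function.comp, (hT i).fixed x hxi hx]
      · rw [hθV i x hxi, zero_mul, zero_mul]
    rw [Finset.sum_congr rfl h1, ← Finset.sum_mul, hθsum x (subset_closure hx), one_mul]
  · refine Filter.Eventually.of_forall fun x => ?_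
    simp only [hP, Function.comp, Finset.mul_sum]
    rw [← Finset.sum_add_distrib]
    exact Finset.sum_congr rfl fun i _ => by ring

/-! ### Assembly of the six estimates. -/

theorem eLpNorm_two_le_of_energy_bound {α F : Type*} [MeasurableSpace α] [NormedAddCommGroup F]
    {μ : Measure α} {f : α → F} {a C b : ℝ} {K : ℝ≥0} {E N : ℝ≥0∞} (ha : 0 ≤ a) (hb : 0 ≤ b)
    (hE : E ^ (1 / 2 : ℝ) ≤ K * N) (hC : √a * K ≤ C)
    (h : ∫⁻ x, ENNReal.ofReal (‖f x‖ ^ 2) ∂μ ≤ ENNReal.ofReal (a * b ^ 2) * E) :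
    eLpNorm f 2 μ ≤ ENNReal.ofReal (C * b) * N := by
  have h1 : a * b ^ 2 = (√a * b) ^ 2 := by rw [mul_pow, Real.sq_sqrt ha]
  rw [h1] at h
  refine (eLpNorm_two_le_of_lintegral_sq_le (by positivity) h).trans ?_
  calc ENNReal.ofReal (√a * b) * E ^ (1 / 2 : ℝ) ≤ ENNReal.ofReal (√a * b) * (K * N) := by gcongr
    _ = ENNReal.ofReal (√a * K * b) * N := by
        rw [← mul_assoc, ← ENNReal.ofReal_coe_nnreal, ← ENNReal.ofReal_mul (by positivity)]
        congr 2; ring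
    _ ≤ _ := by gcongr

theorem lemma2p4 {n : ℕ} (hn : 0 < n) (Ω : Set (Rn n)) (hΩ_open : IsOpen Ω)
    (hΩ_bdd : Bornology.IsBounded Ω) (hΩ_lip : HasLipschitzBoundary Ω)
    (s : ℝ) (hs0 : 0 < s) (hs1 : s < 1) :
    (∃ (K : ℝ≥0) (P : (Rn n → ℝ) → (Rn n → ℝ)), IsHsExtension s Ω K P) ∧
    ∀ K : ℝ≥0, ∃ C : ℝ, 0 < C ∧
      ∀ P : (Rn n → ℝ) → (Rn n → ℝ), IsHsExtension s Ω K P →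
      ∀ ε : ℝ, 0 < ε → ∀ φ : Rn n → ℝ, MemHs s Ω φ →
        eLpNorm (fun x => φ x - cellAverage ε (P φ) x) 2 (volume.restrict Ω)
            ≤ ENNReal.ofReal (C * ε ^ s) * hsNorm s Ω φ ∧
        eLpNorm (fun x => φ x - q1Interp ε (P φ) x) 2 (volume.restrict Ω)
            ≤ ENNReal.ofReal (C * ε ^ s) * hsNorm s Ω φ ∧
        (∃ G : Rn n → Rn n,
          HasWeakGradientOn (enlargement Ω ε 3) (q1Interp ε (P φ)) G ∧
          eLpNorm G 2 (volume.restrict (enlargement Ω ε 3))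
            ≤ ENNReal.ofReal (C * ε ^ (s - 1)) * hsNorm s Ω φ) ∧
        eLpNorm (P φ) 2 (volume.restrict (boundaryLayer Ω ε 3))
            ≤ ENNReal.ofReal (C * ε ^ (s / 2)) * hsNorm s Ω φ ∧
        (∀ i : Fin n,
          eLpNorm (fun x => φ x - P φ (x + ε • EuclideanSpace.single i (1 : ℝ))) 2
              (volume.restrict Ω)
            ≤ ENNReal.ofReal (C * ε ^ s) * hsNorm s Ω φ) ∧
        eLpNorm (q1Interp ε (P φ)) 2 (surfaceMeasure Ω)
            ≤ ENNReal.ofReal (C * ε ^ ((s - 1) / 2)) * hsNorm s Ω φ := by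
  refine ⟨exists_isHsExtension hn hΩ_open hΩ_bdd hΩ_lip hs0 hs1, fun K => ?_⟩
  obtain ⟨M, hM0, hM⟩ := exists_lintegral_thickening_frontier_le hΩ_open hΩ_bdd hΩ_lip hs0 hs1
  obtain ⟨D, hD0, hD⟩ := exists_lintegral_sq_sub_translate_le (n := n) hs0
  obtain ⟨H, hH0, hH⟩ := exists_surfaceMeasure_closedBall_le hΩ_open hΩ_bdd hΩ_lip
  have hfinite := isFiniteMeasure_surfaceMeasure hΩ_open hΩ_bdd hΩ_lip
  set a₁ : ℝ := 2 ^ n * (3 * √n) ^ ((n : ℝ) + 2 * s) with ha₁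
  set a₂ : ℝ := n * n ^ 2 * 2 ^ n * a₁ with ha₂
  set a₃ : ℝ := M * (3 * √n) ^ s with ha₃
  set a₄ : ℝ := 2 ^ n * H * (3 * √n) ^ (n - 1) * a₃ with ha₄
  have h1 : 0 ≤ a₁ := by positivity
  have h2 : 0 ≤ a₂ := by positivity
  have h3 : 0 ≤ a₃ := by positivity
  have h4 : 0 ≤ a₄ := by positivity
  -- The sum dominates the constant of each estimate; the final 1 keeps it positive when `K = 0`.
  refine ⟨√a₁ * K + √a₂ * K + √a₃ * K + √a₄ * K + √D * K + 1, by positivity,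
    fun P hP ε hε φ hφ => ?_⟩
  set C : ℝ := √a₁ * K + √a₂ * K + √a₃ * K + √a₄ * K + √D * K + 1 with hCdef
  have p1 : 0 ≤ √a₁ * K := by positivity
  have p2 : 0 ≤ √a₂ * K := by positivity
  have p3 : 0 ≤ √a₃ * K := by positivity
  have p4 : 0 ≤ √a₄ * K := by positivity
  have p5 : 0 ≤ √D * K := by positivity
  have hum := (hP.memHs φ hφ).1
  rw [Measure.restrict_univ] at hum
  set u := P φ with hu
  -- All the estimates are applied to a measurable representative of the extension.
  set v := hum.mk u with hv
  have hvm : Measurable v := hum.stronglyMeasurable_mk.measurable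
  have huv : u =ᵐ[volume] v := hum.ae_eq_mk
  have hφv : φ =ᵐ[volume.restrict Ω] v :=
    (hP.extends_ae φ hφ).symm.trans (ae_restrict_of_ae huv)
  have hE : hsEnergy s univ v ^ (1 / 2 : ℝ) ≤ K * hsNorm s Ω φ := by
    rw [← hsEnergy_congr_ae (ae_restrict_of_ae huv), ← hsNorm_eq_hsEnergy_rpow]
    exact hP.norm_le φ hφ
  have hgE : gagliardo s univ v ≤ hsEnergy s univ v := le_add_self
  have hsq : ∀ α : ℝ, (ε ^ α) ^ 2 = ε ^ (2 * α) := by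
    intro α
    rw [← Real.rpow_natCast, ← Real.rpow_mul hε.le]
    congr 1; push_cast; ring
  rw [q1Interp_congr_ae hε huv, cellAverage_congr_ae hε huv]
  have hlayer : ∫⁻ x in thickening (3 * √n * ε) (frontier Ω), ENNReal.ofReal (v x ^ 2) ≤
      ENNReal.ofReal (a₃ * (ε ^ (s / 2)) ^ 2) * hsEnergy s univ v := by
    have h5 := hM v hvm (3 * √n * ε) (by
      have : 0 < √(n : ℝ) := Real.sqrt_pos.2 (by exact_mod_cast hn)
      positivity)
    rw [Real.mul_rpow (by positivity) hε.le, ← mul_assoc] at h5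
    rw [hsq, mul_div_cancel₀ s two_ne_zero]
    exact h5
  refine ⟨?_, ?_, ⟨q1Gradient ε v, ?_⟩, ?_, fun i => ?_, ?_⟩
  · rw [eLpNorm_congr_ae (g := fun x => v x - cellAverage ε v x)
      (hφv.mono fun x hx => by simp only [hx])]
    refine eLpNorm_two_le_of_energy_bound h1 (by positivity) hE (by linarith) ?_
    simp only [Real.norm_eq_abs, sq_abs]
    rw [hsq]
    exact (setLIntegral_le_lintegral _ _).trans
      ((lintegral_sq_sub_cellAverage_le hn hs0 hε hvm).trans (mul_le_mul_right hgE _))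
  · rw [eLpNorm_congr_ae (g := fun x => v x - q1Interp ε v x)
      (hφv.mono fun x hx => by simp only [hx])]
    refine eLpNorm_two_le_of_energy_bound h1 (by positivity) hE (by linarith) ?_
    simp only [Real.norm_eq_abs, sq_abs]
    rw [hsq]
    exact (setLIntegral_le_lintegral _ _).trans
      ((lintegral_sq_sub_q1Interp_le hn hs0 hε hvm).trans (mul_le_mul_right hgE _))
  · have hG : eLpNorm (q1Gradient ε v) 2 volume ≤
        ENNReal.ofReal (C * ε ^ (s - 1)) * hsNorm s Ω φ := by
      refine eLpNorm_two_le_of_energy_bound h2 (by positivity) hE (by linarith) ?_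
      exact (lintegral_norm_q1Gradient_sq_le hn hs0 hε hvm).trans (mul_le_mul_right hgE _)
    exact ⟨hasWeakGradientOn_q1Interp hε v
      (hG.trans_lt (ENNReal.mul_lt_top ENNReal.ofReal_lt_top hφ.2)),
      (eLpNorm_mono_measure _ Measure.restrict_le_self).trans hG⟩
  · rw [eLpNorm_congr_ae (ae_restrict_of_ae huv)]
    refine eLpNorm_two_le_of_energy_bound h3 (by positivity) hE (by linarith) ?_
    simpa only [Real.norm_eq_abs, sq_abs, boundaryLayer, Nat.cast_ofNat] using hlayer
  · set w : Rn n := ε • EuclideanSpace.single i (1 : ℝ) with hw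
    have hw1 : ‖w‖ = ε := by simp [hw, norm_smul, abs_of_pos hε]
    have hshift : (fun x => u (x + w)) =ᵐ[volume] fun x => v (x + w) :=
      (measurePreserving_add_right volume w).quasiMeasurePreserving.ae_eq huv
    rw [eLpNorm_congr_ae (g := fun x => v x - v (x + w)) (by
      filter_upwards [hφv, ae_restrict_of_ae hshift] with x hx hx2
      rw [hx, hx2])]
    refine eLpNorm_two_le_of_energy_bound hD0 (by positivity) hE (by linarith) ?_
    simp only [Real.norm_eq_abs, sq_abs]
    rw [hsq, ← hw1]
    exact (setLIntegral_le_lintegral _ _).trans ((hD v hvm w).trans (mul_le_mul_right hgE _))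
  · refine eLpNorm_two_le_of_energy_bound h4 (by positivity) hE (by linarith) ?_
    simp only [Real.norm_eq_abs, sq_abs]
    refine (lintegral_sq_q1Interp_surfaceMeasure_le hn hH0 hH hε hvm).trans ?_
    refine (mul_le_mul_right hlayer _).trans (le_of_eq ?_)
    rw [← mul_assoc, ← ENNReal.ofReal_mul (by positivity), hsq, hsq,
      mul_div_cancel₀ s two_ne_zero, mul_div_cancel₀ (s - 1) two_ne_zero, Real.rpow_sub_one hε.ne',
      ha₄]
    congr 2
    field_simp
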